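/- Let $\gamma_m$ ($m=0,1,2,\dots$) be the Stieltjes constants, defined by the Laurent expansion of the Riemann zeta function at $s=1$, $$\zeta(s)=\frac1{s-1}+\sum_{m=0}^\infty\frac{(-1)^m(s-1)^m}{m!}\,\gamma_m ,\qquad s\neq 1 .$$ Let $|S_1(n,l)|$ be the unsigned Stirling numbers of the first kind ($z(z+1)\cdots(z+n-1)=\sum_{l}|S_1(n,l)|z^l$), let $B_n$ be the Bernoulli numbers ($\sum_n B_n t^n/n! = t/(e^t-1)$), and let $\delta_{m,0}$ be the Kronecker delta. Let $m\ge 0$. (i) For every integer $N\ge 0$ such that $m=0$ or $2N\ge m+1$ (that is, such that the partial sum below has at least one nonvanishing term), there is $\theta\in(0,1)$, in general depending on $m$ and $N$, with $$\gamma_m=\frac12\delta_{m,0}+(-1)^m m!\sum_{k=1}^{N}\frac{|S_1(2k,m+1)|\,B_{2k}}{(2k)!}+\theta\cdot\frac{(-1)^m m!\,|S_1(2N+2,m+1)|\,B_{2N+2}}{(2N+2)!}.$$ (ii) The partial sums $\frac12\delta_{m,0}+(-1)^m m!\sum_{k=1}^{N}|S_1(2k,m+1)|B_{2k}/(2k)!$,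 which are rational, do not converge as $N\to\infty$. Thus this divergent series with rational terms envelops $\gamma_m$. -/

import Mathlib

open Filter Topology
open scoped Nat

noncomputable section

/-- The regular part `ζ(s) - 1/(s-1)` of the Riemann zeta function at its pole `s = 1`,
extended to `s = 1` by its limit there. -/
def zetaRegularPart : ℂ → ℂ :=
  Function.update (fun s : ℂ => riemannZeta s - 1 / (s - 1)) 1
    (limUnder (𝓝[≠] (1 : ℂ)) fun s : ℂ => riemannZeta s - 1 / (s - 1))

/-- The `m`-th Stieltjes constant `γ_m` (generalized Euler constant), read off from the Laurent
expansion `ζ(s) = 1/(s-1) + ∑_{m ≥ 0} (-1)^m γ_m (s-1)^m / m!`; see `hasSum_stieltjesConst`. -/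
def stieltjesConst (m : ℕ) : ℂ :=
  (-1) ^ m * iteratedDeriv m zetaRegularPart 1

theorem differentiable_zetaRegularPart : Differentiable ℂ zetaRegularPart := by
  have hlim : Tendsto (fun s : ℂ => riemannZeta s - 1 / (s - 1)) (𝓝[≠] 1)
      (𝓝 (limUnder (𝓝[≠] (1 : ℂ)) fun s : ℂ => riemannZeta s - 1 / (s - 1))) :=
    tendsto_nhds_limUnder ⟨_, tendsto_riemannZeta_sub_one_div⟩
  have hcont : ContinuousAt zetaRegularPart 1 :=
    continuousAt_update_same.mpr hlim
  have hdiff : DifferentiableOn ℂ zetaRegularPart (Set.univ \ {1}) := by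
    intro s hs
    have hs1 : s ≠ 1 := by simpa using hs
    have h : DifferentiableAt ℂ (fun s : ℂ => riemannZeta s - 1 / (s - 1)) s :=
      (differentiableAt_riemannZeta hs1).sub
        ((differentiableAt_const _).div (differentiableAt_id.sub_const _) (sub_ne_zero.mpr hs1))
    have he : zetaRegularPart =ᶠ[𝓝 s] fun s : ℂ => riemannZeta s - 1 / (s - 1) := by
      filter_upwards [isOpen_ne.mem_nhds hs1] with z hz
      exact Function.update_of_ne hz _ _
    exact (h.congr_of_eventuallyEq he).differentiableWithinAt
  have := (Complex.differentiableOn_compl_singleton_and_continuousAt_iff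
    (s := Set.univ) (c := (1 : ℂ)) Filter.univ_mem).mp ⟨hdiff, hcont⟩
  exact differentiableOn_univ.mp this

/-- The defining Laurent expansion of the Stieltjes constants. -/
theorem hasSum_stieltjesConst {s : ℂ} (hs : s ≠ 1) :
    HasSum (fun m : ℕ => (-1) ^ m * (s - 1) ^ m / (m ! : ℂ) * stieltjesConst m)
      (riemannZeta s - 1 / (s - 1)) := by
  have h := Complex.hasSum_taylorSeries_of_entire differentiable_zetaRegularPart 1 s
  have hv : zetaRegularPart s = riemannZeta s - 1 / (s - 1) := Function.update_of_ne hs _ _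
  rw [hv] at h
  refine h.congr_fun ?_
  intro m
  have h1 : ((-1 : ℂ) ^ m) * (-1) ^ m = 1 := by rw [← mul_pow]; simp
  simp only [stieltjesConst, smul_eq_mul]
  linear_combination ((s - 1) ^ m / (m ! : ℂ) * iteratedDeriv m zetaRegularPart 1) * h1

end

/-- The rational term `(-1)^m m! |S₁(2k, m+1)| B_{2k} / (2k)!`, where `|S₁(n, l)|` is the unsigned
Stirling number of the first kind and `B_n` is the `n`-th Bernoulli number. -/
def stieltjesTerm (m k : ℕ) : ℚ :=
  (-1) ^ m * (m ! : ℚ) * ((Nat.stirlingFirst (2 * k) (m + 1) : ℚ) * bernoulli (2 * k) / ((2 * k)! : ℚ))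

/-- The partial sum `½ δ_{m,0} + ∑_{k=1}^N (-1)^m m! |S₁(2k, m+1)| B_{2k} / (2k)!`. -/
def stieltjesPartialSum (m N : ℕ) : ℚ :=
  (if m = 0 then 1 / 2 else 0) + ∑ k ∈ Finset.Icc 1 N, stieltjesTerm m k

/-! Subtracting the pole, `ζ(s) - 1/(s-1) = 1/2 + E B₀(T)` for `Re s > 0`, where `T` is Gamma
distributed of shape `s` and `B₀(t) = 1/(e^t-1) - 1/t + 1/2 = ∑ 2t/(t²+b²)` over `b = 2π, 4π, …`.
Dividing each fraction repeatedly by `t²+b²` gives kernels `B_N > 0` with `B_N + B_{N+1} = c_{N+1}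
t^(2N+1)`, where `c_j = |B_{2j}|/(2j)!` for `j ≥ 1`. The Gamma mean of `t^n` is the rising factorial
`s(s+1)⋯(s+n-1)`, whose Taylor coefficients at `s = 1` are Stirling numbers. If `R_N` is the `m`-th
derivative at `s = 1` of the Gamma mean of `B_N`, then `γ_m` is the `N`-th partial sum plus
`(-1)^(m+N) R_N`, and `R_N + R_{N+1}` is the absolute value of the next term. So the enveloping
property reduces to `R_N > 0` (`stieltjesRemainder_pos`).

For `m = 0` this is positivity of `B_N`. For `m > 0` the Gamma laws form a convolution semigroup, so
increasing `s` by `δ` replaces `q(y)` by the average of `q(y+x)`. Hence nonnegative `m`-th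
differences of `q` make the `m`-th `s`-derivative of its Gamma mean nonnegative
(`iteratedDeriv_gammaMean_nonneg`). The kernel `B_N` has nonnegative differences up to order `2N-1`
(`fwdNonneg_bernoulliKernel`). Strictness comes from comparison with an explicit function at order
`2N-1` and descends to lower orders by monotonicity.

Divergence holds because the Stirling numbers contribute a factorial, against only geometric decay
of `c_j`. -/

open MeasureTheory Set
open scoped ComplexOrder ContDiff

/-! ### Gamma means as holomorphic functions of the shape -/

/-- Measurable functions on the half line growing at most like `exp (t / 2)`. -/
def ExpTame (q : ℝ → ℝ) : Prop :=
  Measurable q ∧ ∃ C : ℝ, ∀ t : ℝ, 0 < t → |q t| ≤ C * Real.exp (t / 2)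

/-- The expectation of `q` under the Gamma distribution of shape `s`. -/
noncomputable def gammaMean (q : ℝ → ℝ) (s : ℂ) : ℂ :=
  (Complex.Gamma s)⁻¹ * mellin (fun t : ℝ => ((Real.exp (-t) * q t : ℝ) : ℂ)) s

namespace ExpTame

variable {q q₁ q₂ : ℝ → ℝ}

theorem exists_nonneg (h : ExpTame q) :
    ∃ C : ℝ, 0 ≤ C ∧ ∀ t : ℝ, 0 < t → |q t| ≤ C * Real.exp (t / 2) := by
  obtain ⟨C, hC⟩ := h.2
  refine ⟨|C|, abs_nonneg C, fun t ht => (hC t ht).trans ?_⟩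
  gcongr
  exact le_abs_self C

theorem sub (h₁ : ExpTame q₁) (h₂ : ExpTame q₂) : ExpTame fun t => q₁ t - q₂ t := by
  obtain ⟨C₁, hC₁⟩ := h₁.2
  obtain ⟨C₂, hC₂⟩ := h₂.2
  refine ⟨h₁.1.sub h₂.1, C₁ + C₂, fun t ht => ?_⟩
  have := abs_sub (q₁ t) (q₂ t)
  have := hC₁ t ht
  have := hC₂ t ht
  linarith [add_mul C₁ C₂ (Real.exp (t / 2))]

theorem const_mul (h : ExpTame q) (c : ℝ) : ExpTame fun t => c * q t := by
  obtain ⟨C, hC⟩ := h.2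
  refine ⟨h.1.const_mul c, |c| * C, fun t ht => ?_⟩
  rw [abs_mul, mul_assoc]
  exact mul_le_mul_of_nonneg_left (hC t ht) (abs_nonneg c)

theorem add (h₁ : ExpTame q₁) (h₂ : ExpTame q₂) : ExpTame fun t => q₁ t + q₂ t := by
  simpa using h₁.sub (h₂.const_mul (-1))

theorem pow (n : ℕ) : ExpTame fun t => t ^ n := by
  refine ⟨by fun_prop, 2 ^ n * n !, fun t ht => ?_⟩
  have h := Real.pow_div_factorial_le_exp (x := t / 2) (by positivity) n
  rw [div_pow, div_div, div_le_iff₀ (by positivity)] at h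
  rw [abs_of_pos (by positivity)]
  linarith

theorem exp_neg_mul {r : ℝ} (hr : 0 ≤ r) : ExpTame fun t => Real.exp (-(r * t)) := by
  refine ⟨by fun_prop, 1, fun t ht => ?_⟩
  rw [Real.abs_exp, one_mul, Real.exp_le_exp]
  nlinarith [mul_nonneg hr ht.le]

theorem const (c : ℝ) : ExpTame fun _ => c := by
  simpa using (pow 0).const_mul c

theorem integrableOn (h : ExpTame q) :
    IntegrableOn (fun t : ℝ => ((Real.exp (-t) * q t : ℝ) : ℂ)) (Ioi 0) := by
  obtain ⟨C, hC⟩ := h.2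
  have hi : IntegrableOn (fun t : ℝ => C * Real.exp (-(1 / 2) * t)) (Ioi 0) :=
    (integrableOn_exp_mul_Ioi (by norm_num) 0).const_mul C
  refine Integrable.mono' hi ?_ ?_
  · have := h.1
    exact Measurable.aestronglyMeasurable (by fun_prop)
  · filter_upwards [ae_restrict_mem measurableSet_Ioi] with t ht
    rw [Complex.norm_real, Real.norm_eq_abs, abs_mul, Real.abs_exp]
    calc Real.exp (-t) * |q t| ≤ Real.exp (-t) * (C * Real.exp (t / 2)) := by
          gcongr
          exact hC t ht
      _ = C * Real.exp (-(1 / 2) * t) := by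
          rw [mul_left_comm, ← Real.exp_add]
          ring_nf

theorem isBigO_exp (h : ExpTame q) :
    (fun t : ℝ => ((Real.exp (-t) * q t : ℝ) : ℂ)) =O[atTop] fun t => Real.exp (-(1 / 2) * t) := by
  obtain ⟨C, hC⟩ := h.2
  refine Asymptotics.IsBigO.of_bound C ?_
  filter_upwards [eventually_gt_atTop 0] with t ht
  rw [Complex.norm_real, Real.norm_eq_abs, abs_mul, Real.abs_exp, Real.norm_eq_abs, Real.abs_exp]
  calc Real.exp (-t) * |q t| ≤ Real.exp (-t) * (C * Real.exp (t / 2)) := by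
        gcongr
        exact hC t ht
    _ = C * Real.exp (-(1 / 2) * t) := by
        rw [mul_left_comm, ← Real.exp_add]
        ring_nf

/-- Exponent `0` at the origin is what makes the Mellin transform holomorphic on all of `Re s > 0`,
in particular around `s = 1`. -/
theorem isBigO_zero (h : ExpTame q) :
    (fun t : ℝ => ((Real.exp (-t) * q t : ℝ) : ℂ)) =O[𝓝[>] 0] fun t : ℝ => t ^ (-(0 : ℝ)) := by
  obtain ⟨C, hC0, hC⟩ := h.exists_nonneg
  refine Asymptotics.IsBigO.of_bound C ?_
  filter_upwards [self_mem_nhdsWithin] with t ht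
  have ht : 0 < t := ht
  rw [Complex.norm_real, Real.norm_eq_abs, abs_mul, Real.abs_exp]
  calc Real.exp (-t) * |q t| ≤ Real.exp (-t) * (C * Real.exp (t / 2)) := by
        gcongr
        exact hC t ht
    _ = C * Real.exp (-(1 / 2) * t) := by
        rw [mul_left_comm, ← Real.exp_add]
        ring_nf
    _ ≤ C * ‖t ^ (-(0 : ℝ))‖ := by
        simp only [neg_zero, Real.rpow_zero, norm_one]
        gcongr
        rw [Real.exp_le_one_iff]
        linarith

theorem mellinConvergent (h : ExpTame q) {s : ℂ} (hs : 0 < s.re) :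
    MellinConvergent (fun t : ℝ => ((Real.exp (-t) * q t : ℝ) : ℂ)) s :=
  mellinConvergent_of_isBigO_rpow_exp (by norm_num) h.integrableOn.locallyIntegrableOn
    h.isBigO_exp h.isBigO_zero hs

theorem differentiableAt_gammaMean (h : ExpTame q) {s : ℂ} (hs : 0 < s.re) :
    DifferentiableAt ℂ (gammaMean q) s :=
  (Complex.differentiable_one_div_Gamma s).mul
    (mellin_differentiableAt_of_isBigO_rpow_exp (by norm_num) h.integrableOn.locallyIntegrableOn
      h.isBigO_exp h.isBigO_zero hs)

theorem analyticAt_gammaMean (h : ExpTame q) {s : ℂ} (hs : 0 < s.re) :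
    AnalyticAt ℂ (gammaMean q) s := by
  have ho : IsOpen {z : ℂ | 0 < z.re} := isOpen_lt continuous_const Complex.continuous_re
  have hd : DifferentiableOn ℂ (gammaMean q) {z : ℂ | 0 < z.re} := fun z hz =>
    (h.differentiableAt_gammaMean hz).differentiableWithinAt
  exact hd.analyticAt (ho.mem_nhds hs)

theorem gammaMean_sub (h₁ : ExpTame q₁) (h₂ : ExpTame q₂) {s : ℂ} (hs : 0 < s.re) :
    gammaMean (fun t => q₁ t - q₂ t) s = gammaMean q₁ s - gammaMean q₂ s := by
  have h := (hasMellin_sub (h₁.mellinConvergent hs) (h₂.mellinConvergent hs)).2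
  rw [gammaMean, gammaMean, gammaMean, ← mul_sub, ← h]
  congr 3
  funext t
  push_cast
  ring

end ExpTame

theorem gammaMean_const_mul (c : ℝ) (q : ℝ → ℝ) (s : ℂ) :
    gammaMean (fun t => c * q t) s = c * gammaMean q s := by
  have h := mellin_const_smul (fun t : ℝ => ((Real.exp (-t) * q t : ℝ) : ℂ)) s (c : ℂ)
  rw [gammaMean, gammaMean, mul_left_comm, ← smul_eq_mul (c : ℂ) (mellin _ s), ← h]
  congr 3
  funext t
  simp only [smul_eq_mul]
  push_cast
  ring

theorem ExpTame.gammaMean_add {q₁ q₂ : ℝ → ℝ} (h₁ : ExpTame q₁) (h₂ : ExpTame q₂) {s : ℂ}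
    (hs : 0 < s.re) : gammaMean (fun t => q₁ t + q₂ t) s = gammaMean q₁ s + gammaMean q₂ s := by
  have h := h₁.gammaMean_sub (h₂.const_mul (-1)) hs
  rw [gammaMean_const_mul] at h
  simpa using h

theorem gammaMean_exp_neg_mul {r : ℝ} (hr : 0 ≤ r) {s : ℂ} (hs : 0 < s.re) :
    gammaMean (fun t => Real.exp (-(r * t))) s = ((1 + r : ℝ) : ℂ) ^ (-s) := by
  have hΓ := Complex.Gamma_ne_zero_of_re_pos hs
  have h := Complex.integral_cpow_mul_exp_neg_mul_Ioi hs (show 0 < 1 + r by positivity)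
  have h2 : mellin (fun t : ℝ => ((Real.exp (-t) * Real.exp (-(r * t)) : ℝ) : ℂ)) s =
      (1 / ((1 + r : ℝ) : ℂ)) ^ s * Complex.Gamma s := by
    rw [← h, mellin]
    refine setIntegral_congr_fun measurableSet_Ioi fun t ht => ?_
    simp only [smul_eq_mul, ← Real.exp_add]
    push_cast
    ring_nf
  rw [gammaMean, h2, one_div, Complex.inv_cpow, Complex.cpow_neg]
  · field_simp
  · rw [Complex.arg_ofReal_of_nonneg (by positivity)]
    exact Real.pi_pos.ne

/-- The quotient `Γ(s+n)/Γ(s)` telescopes by the functional equation. Stirling numbers enter the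
proof here. -/
theorem gammaMean_pow (n : ℕ) {s : ℂ} (hs : 0 < s.re) :
    gammaMean (fun t => t ^ n) s = (ascPochhammer ℂ n).eval s := by
  have hΓ := Complex.Gamma_ne_zero_of_re_pos hs
  have h2 : mellin (fun t : ℝ => ((Real.exp (-t) * t ^ n : ℝ) : ℂ)) s =
      Complex.Gamma (s + n) := by
    rw [Complex.Gamma_eq_integral (by simp; positivity), Complex.GammaIntegral, mellin]
    refine setIntegral_congr_fun measurableSet_Ioi fun t ht => ?_
    have ht : (t : ℂ) ≠ 0 := by exact_mod_cast (ne_of_gt ht)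
    simp only [smul_eq_mul]
    rw [show s + n - 1 = (s - 1) + n by ring, Complex.cpow_add _ _ ht, Complex.cpow_natCast]
    push_cast
    ring
  have h3 : ∀ n : ℕ, Complex.Gamma (s + n) = (ascPochhammer ℂ n).eval s * Complex.Gamma s := by
    intro n
    induction n with
    | zero => simp
    | succ n ih =>
      have : s + n ≠ 0 := fun h => by
        have := congrArg Complex.re h
        simp at this
        have : (0 : ℝ) ≤ n := n.cast_nonneg
        linarith
      push_cast
      rw [← add_assoc, Complex.Gamma_add_one _ this, ih, ascPochhammer_succ_eval]
      ring
  rw [gammaMean, h2, h3]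
  field_simp

/-! ### The convolution semigroup of Gamma distributions -/

/-- The function `y ↦ E q (y + T)` where `T` is Gamma distributed of shape `δ`. -/
noncomputable def gammaSmooth (δ : ℝ) (q : ℝ → ℝ) (y : ℝ) : ℝ :=
  (Real.Gamma δ)⁻¹ * ∫ x in Ioi (0 : ℝ), x ^ (δ - 1) * (Real.exp (-x) * q (y + x))

theorem integrableOn_rpow_mul_exp_neg_half {δ : ℝ} (hδ : 0 < δ) :
    IntegrableOn (fun x : ℝ => x ^ (δ - 1) * Real.exp (-(x / 2))) (Ioi 0) := by
  have h := integrableOn_rpow_mul_exp_neg_mul_rpow (s := δ - 1) (p := 1) (b := 1 / 2)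
    (by linarith) zero_lt_one (by norm_num)
  refine h.congr_fun (fun x _ => ?_) measurableSet_Ioi
  simp only [Real.rpow_one]
  ring_nf

namespace ExpTame

variable {q : ℝ → ℝ}

theorem norm_gammaSmooth_integrand_le {C δ : ℝ}
    (hC : ∀ t : ℝ, 0 < t → |q t| ≤ C * Real.exp (t / 2)) {y x : ℝ} (hy : 0 < y) (hx : 0 < x) :
    |x ^ (δ - 1) * (Real.exp (-x) * q (y + x))| ≤
      C * Real.exp (y / 2) * (x ^ (δ - 1) * Real.exp (-(x / 2))) := by
  have hx' : 0 ≤ x ^ (δ - 1) := Real.rpow_nonneg hx.le _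
  rw [abs_mul, abs_mul, Real.abs_exp, abs_of_nonneg hx']
  calc x ^ (δ - 1) * (Real.exp (-x) * |q (y + x)|)
      ≤ x ^ (δ - 1) * (Real.exp (-x) * (C * Real.exp ((y + x) / 2))) := by
        gcongr
        exact hC _ (by positivity)
    _ = C * (x ^ (δ - 1) * (Real.exp (-x) * Real.exp ((y + x) / 2))) := by ring
    _ = C * (x ^ (δ - 1) * (Real.exp (y / 2) * Real.exp (-(x / 2)))) := by
        rw [← Real.exp_add, ← Real.exp_add]
        ring_nf
    _ = _ := by ring

theorem integrableOn_gammaSmooth (h : ExpTame q) {δ : ℝ} (hδ : 0 < δ) {y : ℝ} (hy : 0 < y) :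
    IntegrableOn (fun x : ℝ => x ^ (δ - 1) * (Real.exp (-x) * q (y + x))) (Ioi 0) := by
  obtain ⟨C, hC⟩ := h.2
  refine Integrable.mono' ((integrableOn_rpow_mul_exp_neg_half hδ).const_mul
    (C * Real.exp (y / 2))) ?_ ?_
  · have := h.1
    exact Measurable.aestronglyMeasurable (by fun_prop)
  · filter_upwards [ae_restrict_mem measurableSet_Ioi] with x hx
    exact norm_gammaSmooth_integrand_le hC hy hx

theorem gammaSmooth (h : ExpTame q) {δ : ℝ} (hδ : 0 < δ) : ExpTame (gammaSmooth δ q) := by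
  obtain ⟨C, hC⟩ := h.2
  refine ⟨?_, |(Real.Gamma δ)⁻¹| *
    (C * ∫ x in Ioi (0 : ℝ), x ^ (δ - 1) * Real.exp (-(x / 2))), fun y hy => ?_⟩
  · refine Measurable.const_mul ?_ _
    refine (StronglyMeasurable.integral_prod_right
      (f := fun y x : ℝ => x ^ (δ - 1) * (Real.exp (-x) * q (y + x))) ?_).measurable
    have := h.1
    refine Measurable.stronglyMeasurable ?_
    simp only [Function.uncurry_def]
    fun_prop
  · rw [_root_.gammaSmooth, abs_mul, mul_assoc]
    refine mul_le_mul_of_nonneg_left ?_ (abs_nonneg _)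
    rw [mul_right_comm, ← integral_const_mul, ← Real.norm_eq_abs]
    refine norm_integral_le_of_norm_le ((integrableOn_rpow_mul_exp_neg_half hδ).const_mul _) ?_
    filter_upwards [ae_restrict_mem measurableSet_Ioi] with x hx
    exact norm_gammaSmooth_integrand_le hC hy hx

/-- Substitute `t = x + y` and exchange the integrals: for fixed `t` the inner integral over `0 < y
< t` is a scaled Beta integral. -/
theorem integral_smooth_eq (h : ExpTame q) {δ : ℝ} (hδ : 0 < δ) {s : ℂ} (hs : 0 < s.re) :
    ∫ y in Ioi (0 : ℝ), (y : ℂ) ^ (s - 1) * (Real.exp (-y) *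
        ((∫ x in Ioi (0 : ℝ), x ^ (δ - 1) * (Real.exp (-x) * q (y + x)) : ℝ) : ℂ)) =
      Complex.betaIntegral s δ * ∫ t in Ioi (0 : ℝ), (t : ℂ) ^ (s + δ - 1) *
        ((Real.exp (-t) * q t : ℝ) : ℂ) := by
  obtain ⟨C, hC⟩ := h.2
  have hq := h.1
  -- The weight `exp(-t)` is split as `exp(-t/2) exp(-y/2) exp(-(t-y)/2)`. The first factor makes
  -- `q` bounded and the other two make the powers integrable, so Fubini applies to a bounded
  -- function times a convolution integrand.
  let f : ℝ → ℂ := (Ioi (0 : ℝ)).indicator fun y => (y : ℂ) ^ (s - 1) * Real.exp (-(y / 2))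
  let g : ℝ → ℂ := (Ioi (0 : ℝ)).indicator fun x => ((x ^ (δ - 1) * Real.exp (-(x / 2)) : ℝ) : ℂ)
  let w : ℝ → ℂ := (Ioi (0 : ℝ)).indicator fun t => ((Real.exp (-(t / 2)) * q t : ℝ) : ℂ)
  have hf : Integrable f := by
    refine IntegrableOn.integrable_indicator ?_ measurableSet_Ioi
    refine Integrable.mono' (integrableOn_rpow_mul_exp_neg_half hs) ?_ ?_
    · exact Measurable.aestronglyMeasurable (by fun_prop)
    · filter_upwards [ae_restrict_mem measurableSet_Ioi] with y hy
      rw [norm_mul, Complex.norm_cpow_eq_rpow_re_of_pos hy, Complex.norm_real, Real.norm_eq_abs,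
        Real.abs_exp]
      simp
  have hg : Integrable g := by
    refine IntegrableOn.integrable_indicator ?_ measurableSet_Ioi
    exact (integrableOn_rpow_mul_exp_neg_half hδ).ofReal
  have hw : Measurable w := by
    refine Measurable.indicator ?_ measurableSet_Ioi
    fun_prop
  have hwb : ∀ t, ‖w t‖ ≤ |C| := by
    intro t
    by_cases ht : 0 < t
    · simp only [w, indicator_of_mem (show t ∈ Ioi (0 : ℝ) from ht), Complex.norm_real,
        Real.norm_eq_abs, abs_mul, Real.abs_exp]
      calc Real.exp (-(t / 2)) * |q t| ≤ Real.exp (-(t / 2)) * (C * Real.exp (t / 2)) := by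
            gcongr
            exact hC t ht
        _ = C := by
            rw [mul_left_comm, ← Real.exp_add]
            simp
        _ ≤ |C| := le_abs_self C
    · simp [w, ht]
  have hint : Integrable (fun p : ℝ × ℝ => w p.1 * (f p.2 * g (p.1 - p.2)))
      (volume.prod volume) := by
    have := hf.convolution_integrand (ContinuousLinearMap.mul ℝ ℂ) hg
    simp only [ContinuousLinearMap.mul_apply'] at this
    exact this.bdd_mul (c := |C|) (hw.comp measurable_fst).aestronglyMeasurable
      (Eventually.of_forall fun p => hwb p.1)
  have hswap := integral_integral_swap (f := fun t y : ℝ => w t * (f y * g (t - y))) hint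
  have hR : ∀ y : ℝ, ∫ t, w t * (f y * g (t - y)) =
      (Ioi (0 : ℝ)).indicator (fun y : ℝ => (y : ℂ) ^ (s - 1) * (Real.exp (-y) *
        ((∫ x in Ioi (0 : ℝ), x ^ (δ - 1) * (Real.exp (-x) * q (y + x)) : ℝ) : ℂ))) y := by
    intro y
    by_cases hy : 0 < y
    · rw [indicator_of_mem (show y ∈ Ioi (0 : ℝ) from hy)]
      rw [← integral_add_right_eq_self _ y, ← integral_complex_ofReal, ← integral_const_mul,
        ← integral_const_mul, ← integral_indicator measurableSet_Ioi]
      refine integral_congr_ae (Eventually.of_forall fun x => ?_)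
      by_cases hx : 0 < x
      · have hxy : x + y ∈ Ioi (0 : ℝ) := add_pos hx hy
        simp only [f, g, w, indicator_of_mem hxy, add_sub_cancel_right,
          indicator_of_mem (show y ∈ Ioi (0 : ℝ) from hy),
          indicator_of_mem (show x ∈ Ioi (0 : ℝ) from hx), add_comm y x]
        have e : Real.exp (-((x + y) / 2)) * Real.exp (-(y / 2)) * Real.exp (-(x / 2)) =
            Real.exp (-y) * Real.exp (-x) := by
          rw [← Real.exp_add, ← Real.exp_add, ← Real.exp_add]
          ring_nf
        have e' := congrArg (fun r : ℝ => (r : ℂ)) e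
        push_cast at e' ⊢
        linear_combination ((y : ℂ) ^ (s - 1) * (q (x + y) : ℂ) * ((x ^ (δ - 1) : ℝ) : ℂ)) * e'
      · simp [g, hx]
    · simp [f, hy]
  have hL : ∀ t : ℝ, ∫ y, w t * (f y * g (t - y)) =
      (Ioi (0 : ℝ)).indicator (fun t : ℝ => Complex.betaIntegral s δ * ((t : ℂ) ^ (s + δ - 1) *
        ((Real.exp (-t) * q t : ℝ) : ℂ))) t := by
    intro t
    by_cases ht : 0 < t
    · rw [indicator_of_mem (show t ∈ Ioi (0 : ℝ) from ht), mul_left_comm,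
        mul_comm (Complex.betaIntegral s δ), ← mul_assoc, mul_right_comm, mul_comm,
        ← Complex.betaIntegral_scaled _ _ ht,
        intervalIntegral.integral_of_le ht.le, integral_Ioc_eq_integral_Ioo, ← integral_const_mul,
        ← integral_indicator measurableSet_Ioo]
      refine integral_congr_ae (Eventually.of_forall fun y => ?_)
      by_cases hy : y ∈ Ioo 0 t
      · have hty : t - y ∈ Ioi (0 : ℝ) := sub_pos.mpr hy.2
        simp only [f, g, w, indicator_of_mem hy, indicator_of_mem hty,
          indicator_of_mem (show y ∈ Ioi (0 : ℝ) from hy.1),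
          indicator_of_mem (show t ∈ Ioi (0 : ℝ) from ht)]
        have e : Real.exp (-(t / 2)) * Real.exp (-(y / 2)) * Real.exp (-((t - y) / 2)) =
            Real.exp (-t) := by
          rw [← Real.exp_add, ← Real.exp_add]
          ring_nf
        have e' := congrArg (fun r : ℝ => (r : ℂ)) e
        have e2 : (((t - y) ^ (δ - 1) : ℝ) : ℂ) = ((t : ℂ) - y) ^ ((δ : ℂ) - 1) := by
          rw [Complex.ofReal_cpow (le_of_lt hty)]
          push_cast
          rfl
        push_cast [e2] at e' ⊢
        linear_combination ((y : ℂ) ^ (s - 1) * (q t : ℂ) * ((t : ℂ) - y) ^ ((δ : ℂ) - 1)) * e'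
      · rw [indicator_of_notMem hy]
        by_cases hy0 : 0 < y
        · have : ¬ 0 < t - y := fun h' => hy ⟨hy0, sub_pos.mp h'⟩
          simp only [g]
          rw [indicator_of_notMem (show t - y ∉ Ioi (0 : ℝ) from this)]
          simp
        · simp [f, hy0]
    · simp [w, ht]
  simp_rw [hR, hL] at hswap
  rw [integral_indicator measurableSet_Ioi, integral_indicator measurableSet_Ioi] at hswap
  rw [← hswap, integral_const_mul]

/-- The Gamma distributions form a convolution semigroup. -/
theorem gammaMean_gammaSmooth (h : ExpTame q) {δ : ℝ} (hδ : 0 < δ) {s : ℂ} (hs : 0 < s.re) :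
    gammaMean (_root_.gammaSmooth δ q) s = gammaMean q (s + δ) := by
  have hδ' : 0 < (δ : ℂ).re := by simpa using hδ
  have hsδ : 0 < (s + δ : ℂ).re := by simp; linarith
  have h1 := Complex.Gamma_ne_zero_of_re_pos hs
  have h2 := Complex.Gamma_ne_zero_of_re_pos hδ'
  have h3 := Complex.Gamma_ne_zero_of_re_pos hsδ
  have hb := Complex.Gamma_mul_Gamma_eq_betaIntegral hs hδ'
  have hm : mellin (fun t : ℝ => ((Real.exp (-t) * _root_.gammaSmooth δ q t : ℝ) : ℂ)) s =
      (Complex.Gamma δ)⁻¹ * (Complex.betaIntegral s δ *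
        mellin (fun t : ℝ => ((Real.exp (-t) * q t : ℝ) : ℂ)) (s + δ)) := by
    simp only [mellin, smul_eq_mul]
    rw [← h.integral_smooth_eq hδ hs, ← integral_const_mul]
    refine integral_congr_ae (Eventually.of_forall fun y => ?_)
    simp only [_root_.gammaSmooth]
    push_cast [Complex.Gamma_ofReal]
    ring
  rw [gammaMean, gammaMean, hm]
  field_simp
  linear_combination (-mellin (fun t : ℝ => ((Real.exp (-t) * q t : ℝ) : ℂ)) (s + δ)) * hb

end ExpTame

/-! ### Functions with nonnegative forward differences -/

/-- All `m`-fold forward differences of `q` with positive steps are nonnegative on `(0, ∞)`. -/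
def FwdNonneg : ℕ → (ℝ → ℝ) → Prop
  | 0, q => ∀ y : ℝ, 0 < y → 0 ≤ q y
  | m + 1, q => ∀ x : ℝ, 0 < x → FwdNonneg m fun y => q (y + x) - q y

namespace FwdNonneg

theorem congr {m : ℕ} {p q : ℝ → ℝ} (h : FwdNonneg m p) (hpq : ∀ y, 0 < y → p y = q y) :
    FwdNonneg m q := by
  induction m generalizing p q with
  | zero => exact fun y hy => hpq y hy ▸ h y hy
  | succ m ih =>
    intro x hx
    refine ih (h x hx) fun y hy => ?_
    rw [hpq _ (by positivity), hpq y hy]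

theorem const_mul {m : ℕ} {q : ℝ → ℝ} (h : FwdNonneg m q) {c : ℝ} (hc : 0 ≤ c) :
    FwdNonneg m fun y => c * q y := by
  induction m generalizing q with
  | zero => exact fun y hy => mul_nonneg hc (h y hy)
  | succ m ih =>
    intro x hx
    simpa only [mul_sub] using ih (h x hx)

theorem add {m : ℕ} {p q : ℝ → ℝ} (hp : FwdNonneg m p) (hq : FwdNonneg m q) :
    FwdNonneg m fun y => p y + q y := by
  induction m generalizing p q with
  | zero => exact fun y hy => add_nonneg (hp y hy) (hq y hy)
  | succ m ih =>
    intro x hx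
    simpa only [add_sub_add_comm] using ih (hp x hx) (hq x hx)

/-- Differences, unlike derivatives, commute with sums and integrals under mere pointwise
convergence; this is the reason for working with them. -/
theorem tsum {ι : Type*} {m : ℕ} {F : ι → ℝ → ℝ} (h : ∀ i, FwdNonneg m (F i))
    (hs : ∀ y, 0 < y → Summable fun i => F i y) : FwdNonneg m fun y => ∑' i, F i y := by
  induction m generalizing F with
  | zero => exact fun y hy => tsum_nonneg fun i => h i y hy
  | succ m ih =>
    intro x hx
    refine (ih (fun i => h i x hx) fun y hy => (hs _ (by positivity)).sub (hs y hy)).congr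
      fun y hy => ?_
    exact (hs _ (by positivity)).tsum_sub (hs y hy)

theorem integral {α : Type*} [MeasurableSpace α] {μ : Measure α} {m : ℕ} {F : α → ℝ → ℝ}
    (h : ∀ᵐ a ∂μ, FwdNonneg m (F a)) (hi : ∀ y, 0 < y → Integrable (fun a => F a y) μ) :
    FwdNonneg m fun y => ∫ a, F a y ∂μ := by
  induction m generalizing F with
  | zero => exact fun y hy => integral_nonneg_of_ae (h.mono fun a ha => ha y hy)
  | succ m ih =>
    intro x hx
    refine (ih (h.mono fun a ha => ha x hx) fun y hy =>
      (hi _ (by positivity)).sub (hi y hy)).congr fun y hy => ?_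
    exact integral_sub (hi _ (by positivity)) (hi y hy)

/-- A nonnegative derivative of order `m+1` makes the `m`-th derivative monotone, so a first
difference of `q` has nonnegative `m`-th derivative and induction applies. -/
theorem of_iteratedDeriv_nonneg {m : ℕ} {q : ℝ → ℝ} (hq : ContDiff ℝ ∞ q)
    (h : ∀ y, 0 < y → 0 ≤ iteratedDeriv m q y) : FwdNonneg m q := by
  induction m generalizing q with
  | zero => exact fun y hy => by simpa only [iteratedDeriv_zero] using h y hy
  | succ m ih =>
    intro x hx
    have hq' : ContDiff ℝ ∞ fun y => q (y + x) := hq.comp (contDiff_id.add contDiff_const)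
    refine ih (hq'.sub hq) fun y hy => ?_
    have hd : Differentiable ℝ (iteratedDeriv m q) :=
      hq.differentiable_iteratedDeriv m (by exact_mod_cast WithTop.coe_lt_top m)
    have hm : MonotoneOn (iteratedDeriv m q) (Ioi 0) := by
      refine monotoneOn_of_deriv_nonneg (convex_Ioi 0) hd.continuous.continuousOn
        hd.differentiableOn fun z hz => ?_
      rw [interior_Ioi] at hz
      simpa only [iteratedDeriv_succ] using h z hz
    have hle : (m : WithTop ℕ∞) ≤ ∞ := by exact_mod_cast le_top
    have e := iteratedDeriv_sub (x := y) (hq'.of_le hle).contDiffAt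
      (hq.of_le hle).contDiffAt
    simp only [Pi.sub_def] at e
    rw [e, iteratedDeriv_comp_add_const]
    exact sub_nonneg.mpr (hm hy (show 0 < y + x by positivity) (by linarith))

/-- Since the Gamma law has total mass one, the left side is an average over `x > 0` of the
differences `q(y+x) - q(y)`, each of which uses up one order. -/
theorem gammaSmooth_sub {m : ℕ} {q : ℝ → ℝ} (hq : ExpTame q) (h : FwdNonneg (m + 1) q) {δ : ℝ}
    (hδ : 0 < δ) : FwdNonneg m fun y => gammaSmooth δ q y - q y := by
  have hΓ := Real.Gamma_pos_of_pos hδ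
  have hi : ∀ y, 0 < y → IntegrableOn
      (fun x : ℝ => x ^ (δ - 1) * (Real.exp (-x) * q (y + x)) -
        x ^ (δ - 1) * (Real.exp (-x) * q y)) (Ioi 0) := by
    intro y hy
    refine (hq.integrableOn_gammaSmooth hδ hy).sub ?_
    exact (ExpTame.const (q y)).integrableOn_gammaSmooth hδ hy
  have hF : ∀ᵐ x ∂(volume.restrict (Ioi (0 : ℝ))), FwdNonneg m fun y =>
      x ^ (δ - 1) * (Real.exp (-x) * q (y + x)) - x ^ (δ - 1) * (Real.exp (-x) * q y) := by
    filter_upwards [ae_restrict_mem measurableSet_Ioi] with x hx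
    have hc : 0 ≤ x ^ (δ - 1) * Real.exp (-x) :=
      mul_nonneg (Real.rpow_nonneg (le_of_lt hx) _) (Real.exp_pos _).le
    simpa only [mul_sub, mul_assoc] using (h x hx).const_mul hc
  refine ((integral hF hi).const_mul (inv_nonneg.mpr hΓ.le)).congr fun y hy => ?_
  rw [integral_sub (hq.integrableOn_gammaSmooth hδ hy)
    ((ExpTame.const (q y)).integrableOn_gammaSmooth hδ hy), mul_sub, gammaSmooth]
  congr 1
  have e : ∫ x in Ioi (0 : ℝ), x ^ (δ - 1) * (Real.exp (-x) * q y) = Real.Gamma δ * q y := by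
    rw [Real.Gamma_eq_integral hδ, ← integral_mul_const]
    congr 1
    funext x
    ring
  rw [e]
  field_simp

end FwdNonneg

/-! ### Signs of derivatives in the shape parameter -/

theorem gammaMean_ofReal (q : ℝ → ℝ) (s : ℝ) :
    gammaMean q s = (((Real.Gamma s)⁻¹ *
      ∫ t in Ioi (0 : ℝ), t ^ (s - 1) * (Real.exp (-t) * q t) : ℝ) : ℂ) := by
  rw [gammaMean, mellin, Complex.ofReal_mul, ← integral_complex_ofReal, Complex.Gamma_ofReal,
    Complex.ofReal_inv]
  congr 1
  refine setIntegral_congr_fun measurableSet_Ioi fun t ht => ?_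
  simp only [smul_eq_mul]
  rw [Complex.ofReal_mul (t ^ (s - 1)), Complex.ofReal_cpow (le_of_lt ht)]
  push_cast
  rfl

namespace ExpTame

variable {q : ℝ → ℝ}

theorem analyticAt_iteratedDeriv (h : ExpTame q) (m : ℕ) {s : ℂ} (hs : 0 < s.re) :
    AnalyticAt ℂ (iteratedDeriv m (gammaMean q)) s := by
  rw [iteratedDeriv_eq_iterate]
  exact (h.analyticAt_gammaMean hs).iterated_deriv m

theorem iteratedDeriv_gammaMean_add (h : ExpTame q) (m : ℕ) {δ : ℝ} (hδ : 0 < δ) {s : ℂ}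
    (hs : 0 < s.re) : iteratedDeriv m (gammaMean q) (s + δ) =
      iteratedDeriv m (gammaMean (_root_.gammaSmooth δ q)) s := by
  have ho : IsOpen {z : ℂ | 0 < z.re} := isOpen_lt continuous_const Complex.continuous_re
  have he : gammaMean (_root_.gammaSmooth δ q) =ᶠ[𝓝 s] fun z => gammaMean q (z + δ) := by
    filter_upwards [ho.mem_nhds hs] with z hz
    exact h.gammaMean_gammaSmooth hδ hz
  rw [he.iteratedDeriv_eq, iteratedDeriv_comp_add_const]

theorem iteratedDeriv_gammaMean_sub {p : ℝ → ℝ} (hp : ExpTame p) (hq : ExpTame q) (m : ℕ) {s : ℂ}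
    (hs : 0 < s.re) : iteratedDeriv m (gammaMean fun t => p t - q t) s =
      iteratedDeriv m (gammaMean p) s - iteratedDeriv m (gammaMean q) s := by
  have ho : IsOpen {z : ℂ | 0 < z.re} := isOpen_lt continuous_const Complex.continuous_re
  have he : gammaMean (fun t => p t - q t) =ᶠ[𝓝 s] gammaMean p - gammaMean q := by
    filter_upwards [ho.mem_nhds hs] with z hz
    exact hp.gammaMean_sub hq hz
  rw [he.iteratedDeriv_eq, iteratedDeriv_sub (hp.analyticAt_gammaMean hs).contDiffAt
    (hq.analyticAt_gammaMean hs).contDiffAt]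

/-- By the semigroup property, the right difference quotient in `s` is `δ⁻¹` times the same
expression of one order less for `gammaSmooth δ q - q`, whose differences of that order are
nonnegative. -/
theorem iteratedDeriv_gammaMean_nonneg (h : ExpTame q) {m : ℕ} (hm : FwdNonneg m q) {s : ℝ}
    (hs : 0 < s) : 0 ≤ iteratedDeriv m (gammaMean q) s := by
  induction m generalizing q with
  | zero =>
    rw [iteratedDeriv_zero, gammaMean_ofReal, Complex.zero_le_real]
    refine mul_nonneg (inv_nonneg.mpr (Real.Gamma_pos_of_pos hs).le) ?_
    refine setIntegral_nonneg measurableSet_Ioi fun t ht => ?_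
    exact mul_nonneg (Real.rpow_nonneg (le_of_lt ht) _)
      (mul_nonneg (Real.exp_pos _).le (hm t ht))
  | succ m ih =>
    have hs' : 0 < (s : ℂ).re := by simpa using hs
    have hd := (h.analyticAt_iteratedDeriv m hs').differentiableAt.hasDerivAt.comp_ofReal
    rw [← iteratedDeriv_succ] at hd
    refine ge_of_tendsto hd.tendsto_slope_zero_right ?_
    filter_upwards [self_mem_nhdsWithin] with δ hδ
    have hδ : 0 < δ := hδ
    rw [Complex.ofReal_add, h.iteratedDeriv_gammaMean_add m hδ hs',
      ← (h.gammaSmooth hδ).iteratedDeriv_gammaMean_sub h m hs', Complex.real_smul]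
    refine mul_nonneg ?_ (ih ((h.gammaSmooth hδ).sub h) (hm.gammaSmooth_sub h hδ))
    exact_mod_cast (inv_pos.mpr hδ).le

/-- Descending induction: a positive derivative of order `j+1` makes the one of order `j`, already
nonnegative, strictly increasing. -/
theorem iteratedDeriv_gammaMean_pos (h : ExpTame q) {M : ℕ} (hM : ∀ j ≤ M, FwdNonneg j q)
    (hpos : ∀ s : ℝ, 1 / 2 < s → s ≤ 1 → 0 < iteratedDeriv M (gammaMean q) s) {j : ℕ} (hj : j ≤ M)
    {s : ℝ} (hs : 1 / 2 < s) (hs1 : s ≤ 1) : 0 < iteratedDeriv j (gammaMean q) s := by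
  induction hj using Nat.decreasingInduction generalizing s with
  | self => exact hpos s hs hs1
  | @of_succ j hj ih =>
    have hd : ∀ x : ℝ, 0 < x → HasDerivAt (fun x : ℝ => (iteratedDeriv j (gammaMean q) x).re)
        (iteratedDeriv (j + 1) (gammaMean q) x).re x := by
      intro x hx
      have hd := (h.analyticAt_iteratedDeriv j (s := x) (by simpa using hx)).differentiableAt
      rw [iteratedDeriv_succ]
      exact hd.hasDerivAt.real_of_complex
    have hmono : StrictMonoOn (fun x : ℝ => (iteratedDeriv j (gammaMean q) x).re)
        (Ioc (1 / 2) 1) := by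
      refine strictMonoOn_of_deriv_pos (convex_Ioc _ _) (fun x hx => ?_) fun x hx => ?_
      · exact (hd x (by linarith [hx.1])).continuousAt.continuousWithinAt
      · rw [interior_Ioc] at hx
        rw [(hd x (by linarith [hx.1])).deriv]
        exact (Complex.pos_iff.mp (ih hx.1 hx.2.le)).1
    -- The midpoint of `1/2` and `s` is a point to the left of `s`, still in the interval, where the
    -- value is nonnegative.
    have h0 := Complex.nonneg_iff.mp
      (h.iteratedDeriv_gammaMean_nonneg (hM j (by omega)) (s := (s + 1 / 2) / 2) (by linarith))
    have h1 := Complex.nonneg_iff.mp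
      (h.iteratedDeriv_gammaMean_nonneg (hM j (by omega)) (s := s) (by linarith))
    have hlt := hmono (a := (s + 1 / 2) / 2) (b := s) ⟨by linarith, by linarith⟩ ⟨hs, hs1⟩
      (by linarith)
    exact Complex.pos_iff.mpr ⟨h0.1.trans_lt hlt, h1.2⟩

end ExpTame

/-! ### Derivatives of the single-pole kernels -/

/-- The kernel `t ^ (2 n + 1) / (t ^ 2 + b ^ 2)`. -/
noncomputable def poleKernel (n : ℕ) (b t : ℝ) : ℝ := t ^ (2 * n + 1) / (t ^ 2 + b ^ 2)

theorem contDiff_poleKernel (n : ℕ) {b : ℝ} (hb : 0 < b) : ContDiff ℝ ∞ (poleKernel n b) := by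
  refine (contDiff_id.pow _).div ((contDiff_id.pow 2).add contDiff_const) fun t => ?_
  have : 0 < t ^ 2 + b ^ 2 := by positivity
  exact this.ne'

theorem poleKernel_succ (n : ℕ) {b : ℝ} (hb : 0 < b) (t : ℝ) :
    poleKernel (n + 1) b t = t ^ (2 * n + 1) - b ^ 2 * poleKernel n b t := by
  have : t ^ 2 + b ^ 2 ≠ 0 := by positivity
  simp only [poleKernel]
  field_simp
  ring

theorem iteratedDeriv_pow_eq_zero {n m : ℕ} (h : n < m) (t : ℝ) :
    iteratedDeriv m (fun t : ℝ => t ^ n) t = 0 := by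
  rw [iteratedDeriv_pow, Nat.descFactorial_eq_zero_iff_lt.mpr h]
  simp

theorem iteratedDeriv_pow_self (n : ℕ) (t : ℝ) :
    iteratedDeriv n (fun t : ℝ => t ^ n) t = n ! := by
  rw [iteratedDeriv_pow, Nat.descFactorial_self]
  simp

theorem iteratedDeriv_poleKernel_succ (m n : ℕ) {b : ℝ} (hb : 0 < b) (t : ℝ) :
    iteratedDeriv m (poleKernel (n + 1) b) t =
      iteratedDeriv m (fun t : ℝ => t ^ (2 * n + 1)) t -
        b ^ 2 * iteratedDeriv m (poleKernel n b) t := by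
  have hle : (m : WithTop ℕ∞) ≤ ∞ := by exact_mod_cast le_top
  have e : poleKernel (n + 1) b =
      (fun t : ℝ => t ^ (2 * n + 1)) - fun t => b ^ 2 * poleKernel n b t :=
    funext fun t => poleKernel_succ n hb t
  rw [e, iteratedDeriv_sub (by fun_prop)
    (contDiff_const.mul ((contDiff_poleKernel n hb).of_le hle)).contDiffAt,
    iteratedDeriv_const_mul_field]

/-- Repeated division by `t²+b²` reduces to the case `n = 0` up to a polynomial of degree below
`2n`, which `m` derivatives annihilate. -/
theorem iteratedDeriv_poleKernel_of_le {m n : ℕ} (h : 2 * n ≤ m) {b : ℝ} (hb : 0 < b) (t : ℝ) :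
    iteratedDeriv m (poleKernel n b) t =
      (-1) ^ n * b ^ (2 * n) * iteratedDeriv m (poleKernel 0 b) t := by
  induction n with
  | zero => simp
  | succ n ih =>
    rw [iteratedDeriv_poleKernel_succ m n hb, iteratedDeriv_pow_eq_zero (by omega),
      ih (by omega)]
    ring

/-- On the real line `t/(t²+b²)` is the real part of `1/(t+ib)`. -/
theorem iteratedDeriv_poleKernel_zero (m : ℕ) {b : ℝ} (hb : 0 < b) (t : ℝ) :
    iteratedDeriv m (poleKernel 0 b) t =
      ((-1) ^ m * (m ! : ℂ) * (((t : ℂ) + b * Complex.I) ^ (m + 1))⁻¹).re := by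
  have hne : ∀ t : ℝ, (t : ℂ) + b * Complex.I ≠ 0 := fun t h => by
    have := congrArg Complex.im h
    simp at this
    exact hb.ne' this
  induction m generalizing t with
  | zero =>
    rw [iteratedDeriv_zero]
    simp [poleKernel, Complex.inv_re, Complex.normSq_apply]
    ring
  | succ m ih =>
    rw [iteratedDeriv_succ, funext ih]
    have h1 : HasDerivAt (fun z : ℂ => (-1) ^ m * (m ! : ℂ) * ((z + b * Complex.I) ^ (m + 1))⁻¹)
        ((-1) ^ m * (m ! : ℂ) * (-(((m + 1 : ℕ) : ℂ) * ((t : ℂ) + b * Complex.I) ^ m * 1) /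
          (((t : ℂ) + b * Complex.I) ^ (m + 1)) ^ 2)) (t : ℂ) := by
      refine HasDerivAt.const_mul _ ?_
      exact (((hasDerivAt_id (t : ℂ)).add_const _).pow (m + 1)).inv (pow_ne_zero _ (hne t))
    rw [h1.real_of_complex.deriv]
    congr 1
    have := hne t
    rw [Nat.factorial_succ]
    push_cast
    field_simp
    ring

theorem abs_iteratedDeriv_poleKernel_zero_le (n : ℕ) {b : ℝ} (hb : 0 < b) (t : ℝ) :
    |iteratedDeriv (2 * n + 1) (poleKernel 0 b) t| ≤
      (2 * n + 1)! / (t ^ 2 + b ^ 2) ^ (n + 1) := by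
  rw [iteratedDeriv_poleKernel_zero _ hb]
  refine (Complex.abs_re_le_norm _).trans (le_of_eq ?_)
  have h : ‖(t : ℂ) + b * Complex.I‖ ^ 2 = t ^ 2 + b ^ 2 := by
    rw [Complex.sq_norm, Complex.normSq_add_mul_I]
  rw [norm_mul, norm_mul, norm_pow, norm_neg, norm_one, one_pow, one_mul, norm_inv, norm_pow,
    Complex.norm_natCast, show 2 * n + 1 + 1 = 2 * (n + 1) by ring, pow_mul, h, div_eq_mul_inv]

/-- With `r = b²/(t²+b²) ≤ 1`, one division and the bound on the derivative of `1/(t+ib)` leave at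
least `(2n+1)! (1 - r^(n+1)) ≥ (2n+1)! (1 - r)`. -/
theorem le_iteratedDeriv_poleKernel (n : ℕ) {b : ℝ} (hb : 0 < b) (t : ℝ) :
    (2 * n + 1)! * (t ^ 2 / (t ^ 2 + b ^ 2)) ≤
      iteratedDeriv (2 * n + 1) (poleKernel (n + 1) b) t := by
  have hu : 0 < t ^ 2 + b ^ 2 := by positivity
  have hr : b ^ 2 / (t ^ 2 + b ^ 2) ≤ 1 := by
    rw [div_le_one hu]
    nlinarith [sq_nonneg t]
  have hr0 : 0 ≤ b ^ 2 / (t ^ 2 + b ^ 2) := by positivity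
  rw [iteratedDeriv_poleKernel_succ _ _ hb, iteratedDeriv_pow_self,
    iteratedDeriv_poleKernel_of_le (show 2 * n ≤ 2 * n + 1 by omega) hb]
  have hb2 : b ^ 2 * ((-1) ^ n * b ^ (2 * n) * iteratedDeriv (2 * n + 1) (poleKernel 0 b) t) ≤
      (2 * n + 1)! * (b ^ 2 / (t ^ 2 + b ^ 2)) := by
    calc _ ≤ |b ^ 2 * ((-1) ^ n * b ^ (2 * n) * iteratedDeriv (2 * n + 1) (poleKernel 0 b) t)| :=
          le_abs_self _
      _ = b ^ (2 * (n + 1)) * |iteratedDeriv (2 * n + 1) (poleKernel 0 b) t| := by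
          simp only [abs_mul, abs_pow, abs_neg, abs_one, one_pow, abs_of_pos hb]
          ring
      _ ≤ b ^ (2 * (n + 1)) * ((2 * n + 1)! / (t ^ 2 + b ^ 2) ^ (n + 1)) := by
          gcongr
          exact abs_iteratedDeriv_poleKernel_zero_le n hb t
      _ = (2 * n + 1)! * ((b ^ 2 / (t ^ 2 + b ^ 2)) ^ (n + 1)) := by
          rw [div_pow, ← pow_mul]
          ring
      _ ≤ (2 * n + 1)! * (b ^ 2 / (t ^ 2 + b ^ 2)) := by
          gcongr
          exact pow_le_of_le_one hr0 hr (by omega)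
  have e : t ^ 2 / (t ^ 2 + b ^ 2) = 1 - b ^ 2 / (t ^ 2 + b ^ 2) := by
    field_simp
    ring
  rw [e, mul_sub, mul_one]
  linarith

theorem iteratedDeriv_poleKernel_at_zero {m n : ℕ} (h : m < 2 * n + 1) {b : ℝ} (hb : 0 < b) :
    iteratedDeriv m (poleKernel n b) 0 = 0 := by
  have hinv : AnalyticAt ℝ (fun t : ℝ => (t ^ 2 + b ^ 2)⁻¹) 0 := by
    refine AnalyticAt.inv (by fun_prop) ?_
    positivity
  have hQ : AnalyticAt ℝ (poleKernel n b) 0 := by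
    have : AnalyticAt ℝ (fun t : ℝ => t ^ (2 * n + 1) * (t ^ 2 + b ^ 2)⁻¹) 0 :=
      (analyticAt_id.pow _).mul hinv
    exact this.congr (Eventually.of_forall fun t => (div_eq_mul_inv _ _).symm)
  refine (natCast_le_analyticOrderAt_iff_iteratedDeriv_eq_zero (n := 2 * n + 1) hQ).mp ?_ m h
  rw [natCast_le_analyticOrderAt hQ]
  refine ⟨_, hinv, Eventually.of_forall fun t => ?_⟩
  simp [poleKernel, div_eq_mul_inv]

theorem iteratedDeriv_nonneg_of_top {f : ℝ → ℝ} (hf : ContDiff ℝ ∞ f) {M : ℕ}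
    (h0 : ∀ j < M, iteratedDeriv j f 0 = 0) (hM : ∀ y, 0 ≤ y → 0 ≤ iteratedDeriv M f y)
    {j : ℕ} (hj : j ≤ M) {y : ℝ} (hy : 0 ≤ y) : 0 ≤ iteratedDeriv j f y := by
  induction hj using Nat.decreasingInduction generalizing y with
  | self => exact hM y hy
  | @of_succ j hj ih =>
    have hd : Differentiable ℝ (iteratedDeriv j f) :=
      hf.differentiable_iteratedDeriv j (by exact_mod_cast WithTop.coe_lt_top j)
    have hm : MonotoneOn (iteratedDeriv j f) (Ici 0) := by
      refine monotoneOn_of_deriv_nonneg (convex_Ici 0) hd.continuous.continuousOn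
        hd.differentiableOn fun z hz => ?_
      rw [interior_Ici] at hz
      simpa only [iteratedDeriv_succ] using ih (le_of_lt hz)
    simpa [h0 j hj] using hm (a := 0) (b := y) self_mem_Ici hy hy

/-- The derivative of order `2n+1` is nonnegative and the lower ones vanish at the origin, a zero of
order `2n+3`; integrating from `0` propagates the sign downwards. -/
theorem fwdNonneg_poleKernel {m n : ℕ} (h : m ≤ 2 * n + 1) {b : ℝ} (hb : 0 < b) :
    FwdNonneg m (poleKernel (n + 1) b) := by
  refine FwdNonneg.of_iteratedDeriv_nonneg (contDiff_poleKernel _ hb) fun y hy => ?_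
  refine iteratedDeriv_nonneg_of_top (contDiff_poleKernel _ hb) (fun j hj => ?_)
    (fun z _ => ?_) h hy.le
  · exact iteratedDeriv_poleKernel_at_zero (by omega) hb
  · exact (le_iteratedDeriv_poleKernel n hb z).trans' (by positivity)

/-! ### An explicit comparison function -/

/-- A comparison function whose `(2 n + 1)`-st derivative is `(1 - exp (-t)) ^ 2`. -/
noncomputable def comparisonFun (n : ℕ) (t : ℝ) : ℝ :=
  ((2 * n + 1)! : ℝ)⁻¹ * t ^ (2 * n + 1) +
    (2 * Real.exp (-(1 * t)) - (2 ^ (2 * n + 1) : ℝ)⁻¹ * Real.exp (-(2 * t)))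

theorem iteratedDeriv_comparisonFun (n : ℕ) (t : ℝ) :
    iteratedDeriv (2 * n + 1) (comparisonFun n) t = (1 - Real.exp (-t)) ^ 2 := by
  have e : comparisonFun n = (fun t : ℝ => ((2 * n + 1)! : ℝ)⁻¹ * t ^ (2 * n + 1)) +
      fun t => 2 * Real.exp (-1 * t) - (2 ^ (2 * n + 1) : ℝ)⁻¹ * Real.exp (-2 * t) := by
    funext t
    simp [comparisonFun]
  have h2 : (-2 : ℝ) ^ (2 * n + 1) = -2 ^ (2 * n + 1) := (odd_two_mul_add_one n).neg_pow 2
  have hexp : Real.exp (-2 * t) = Real.exp (-t) ^ 2 := by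
    rw [← Real.exp_nat_mul]
    norm_num
  rw [e, iteratedDeriv_add (by fun_prop) (by fun_prop),
    iteratedDeriv_fun_sub (by fun_prop) (by fun_prop), iteratedDeriv_const_mul_field, iteratedDeriv_const_mul_field,
    iteratedDeriv_const_mul_field, iteratedDeriv_exp_const_mul, iteratedDeriv_exp_const_mul, iteratedDeriv_pow_self]
  simp only [h2, hexp, (odd_two_mul_add_one n).neg_one_pow, neg_one_mul]
  have : ((2 * n + 1)! : ℝ) ≠ 0 := by positivity
  field_simp
  ring

/-- For `y > 0`, `(1 - e^(-y))²` is at most both `1` and `y²`, hence at most `(1+b²) y²/(y²+b²)`. -/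
theorem fwdNonneg_poleKernel_sub (n : ℕ) {b : ℝ} (hb : 0 < b) :
    FwdNonneg (2 * n + 1) fun t => poleKernel (n + 1) b t -
      (2 * n + 1)! / (1 + b ^ 2) * comparisonFun n t := by
  have hc : ContDiff ℝ ∞ (comparisonFun n) := by
    unfold comparisonFun
    fun_prop
  have hQ := contDiff_poleKernel (n + 1) hb
  have hle : ((2 * n + 1 : ℕ) : WithTop ℕ∞) ≤ ∞ :=
    WithTop.coe_le_coe.mpr (le_top : ((2 * n + 1 : ℕ) : ℕ∞) ≤ ⊤)
  refine FwdNonneg.of_iteratedDeriv_nonneg (hQ.sub (contDiff_const.mul hc)) fun y hy => ?_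
  have e := iteratedDeriv_sub (x := y) (hQ.of_le hle).contDiffAt
    ((contDiff_const (c := ((2 * n + 1)! / (1 + b ^ 2) : ℝ))).mul hc |>.of_le hle).contDiffAt
  simp only [Pi.sub_def] at e
  rw [e, iteratedDeriv_const_mul_field, iteratedDeriv_comparisonFun, sub_nonneg]
  refine (le_iteratedDeriv_poleKernel n hb y).trans' ?_
  rw [div_mul_eq_mul_div, mul_div_assoc]
  gcongr (2 * n + 1)! * ?_
  rw [div_le_div_iff₀ (by positivity) (by positivity)]
  have h0 : 0 ≤ 1 - Real.exp (-y) := by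
    rw [sub_nonneg, Real.exp_le_one_iff]
    linarith
  have h1 : 1 - Real.exp (-y) ≤ 1 := by linarith [Real.exp_pos (-y)]
  have h2 : 1 - Real.exp (-y) ≤ y := by linarith [Real.add_one_le_exp (-y)]
  have h1' : (1 - Real.exp (-y)) ^ 2 ≤ 1 := pow_le_one₀ h0 h1
  have h2' : (1 - Real.exp (-y)) ^ 2 ≤ y ^ 2 := pow_le_pow_left₀ h0 h2 2
  nlinarith [mul_le_mul_of_nonneg_right h1' (sq_nonneg y),
    mul_le_mul_of_nonneg_right h2' (sq_nonneg b)]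

theorem iteratedDeriv_polynomial_eval (p : Polynomial ℂ) (m : ℕ) (s : ℂ) :
    iteratedDeriv m (fun s => p.eval s) s = m ! * (Polynomial.taylor s p).coeff m := by
  have h : ∀ m : ℕ, iteratedDeriv m (fun s => p.eval s) =
      fun s => (Polynomial.derivative^[m] p).eval s := by
    intro m
    induction m with
    | zero => simp
    | succ m ih =>
      rw [iteratedDeriv_succ, ih]
      funext s
      rw [Polynomial.deriv, Function.iterate_succ_apply']
  rw [h, Polynomial.taylor_coeff, ← Polynomial.factorial_smul_hasseDeriv]
  simp

theorem ExpTame.comparisonFun (n : ℕ) : ExpTame (comparisonFun n) :=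
  ((ExpTame.pow _).const_mul _).add
    (((ExpTame.exp_neg_mul zero_le_one).const_mul _).sub
      ((ExpTame.exp_neg_mul zero_le_two).const_mul _))

theorem gammaMean_comparisonFun (n : ℕ) {s : ℂ} (hs : 0 < s.re) :
    gammaMean (comparisonFun n) s =
      ((2 * n + 1)! : ℂ)⁻¹ * (ascPochhammer ℂ (2 * n + 1)).eval s +
        (2 * Complex.exp (-(Real.log 2 : ℂ) * s) -
          (2 ^ (2 * n + 1) : ℂ)⁻¹ * Complex.exp (-(Real.log 3 : ℂ) * s)) := by
  have e : ∀ r : ℝ, 0 < r → (r : ℂ) ^ (-s) = Complex.exp (-(Real.log r : ℂ) * s) := by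
    intro r hr
    rw [Complex.cpow_def_of_ne_zero (by exact_mod_cast hr.ne'), Complex.ofReal_log hr.le]
    ring_nf
  unfold comparisonFun
  rw [((ExpTame.pow _).const_mul _).gammaMean_add
    (((ExpTame.exp_neg_mul zero_le_one).const_mul _).sub
      ((ExpTame.exp_neg_mul zero_le_two).const_mul _)) hs,
    ((ExpTame.exp_neg_mul zero_le_one).const_mul _).gammaMean_sub
      ((ExpTame.exp_neg_mul zero_le_two).const_mul _) hs, gammaMean_const_mul,
    gammaMean_const_mul, gammaMean_const_mul, gammaMean_pow _ hs,
    gammaMean_exp_neg_mul zero_le_one hs, gammaMean_exp_neg_mul zero_le_two hs,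
    show (1 + 1 : ℝ) = 2 by norm_num, show (1 + 2 : ℝ) = 3 by norm_num, e 2 (by norm_num),
    e 3 (by norm_num)]
  push_cast
  rfl

/-- With `M = 2n+1`, the derivative equals `1 - 2 (log 2)^M 2^(-s) + 2^(-M) (log 3)^M 3^(-s)`. The
middle term is below `1` in size once `s > 1/2`, which is the origin of that threshold. -/
theorem iteratedDeriv_gammaMean_comparisonFun_pos (n : ℕ) {s : ℝ} (hs : 1 / 2 < s) :
    0 < iteratedDeriv (2 * n + 1) (gammaMean (comparisonFun n)) s := by
  have ho : IsOpen {z : ℂ | 0 < z.re} := isOpen_lt continuous_const Complex.continuous_re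
  have hs' : 0 < (s : ℂ).re := by
    rw [Complex.ofReal_re]
    linarith
  have he : gammaMean (comparisonFun n) =ᶠ[𝓝 (s : ℂ)]
      (fun s : ℂ => ((2 * n + 1)! : ℂ)⁻¹ * (ascPochhammer ℂ (2 * n + 1)).eval s) +
        fun s => 2 * Complex.exp (-(Real.log 2 : ℂ) * s) -
          (2 ^ (2 * n + 1) : ℂ)⁻¹ * Complex.exp (-(Real.log 3 : ℂ) * s) := by
    filter_upwards [ho.mem_nhds hs'] with z hz
    exact gammaMean_comparisonFun n hz
  have hp : ContDiff ℂ ((2 * n + 1 : ℕ) : WithTop ℕ∞)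
      fun s : ℂ => (ascPochhammer ℂ (2 * n + 1)).eval s := by
    have := (ascPochhammer ℂ (2 * n + 1)).contDiff_aeval (𝕜 := ℂ) ((2 * n + 1 : ℕ) : WithTop ℕ∞)
    simpa only [Polynomial.coe_aeval_eq_eval] using this
  have hlead : (Polynomial.taylor (s : ℂ) (ascPochhammer ℂ (2 * n + 1))).coeff (2 * n + 1) =
      1 := by
    have hm := monic_ascPochhammer ℂ (2 * n + 1)
    have := Polynomial.coeff_taylor_natDegree (r := (s : ℂ)) (f := ascPochhammer ℂ (2 * n + 1))
    rwa [ascPochhammer_natDegree, hm.leadingCoeff] at this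
  have hfac : ((2 * n + 1)! : ℂ) ≠ 0 := by exact_mod_cast Nat.factorial_ne_zero _
  rw [he.iteratedDeriv_eq, iteratedDeriv_add (contDiff_const.mul hp).contDiffAt
      (by fun_prop),
    iteratedDeriv_fun_sub (by fun_prop) (by fun_prop), iteratedDeriv_const_mul_field,
    iteratedDeriv_const_mul_field, iteratedDeriv_const_mul_field, iteratedDeriv_polynomial_eval,
    hlead, iteratedDeriv_cexp_const_mul, iteratedDeriv_cexp_const_mul]
  simp only [(odd_two_mul_add_one n).neg_pow]
  have hval : ((2 * n + 1)! : ℂ)⁻¹ * ((2 * n + 1)! * 1) +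
      (2 * (-(Real.log 2 : ℂ) ^ (2 * n + 1) * Complex.exp (-(Real.log 2 : ℂ) * s)) -
        (2 ^ (2 * n + 1) : ℂ)⁻¹ *
          (-(Real.log 3 : ℂ) ^ (2 * n + 1) * Complex.exp (-(Real.log 3 : ℂ) * s))) =
      ((1 - 2 * (Real.log 2 ^ (2 * n + 1) * Real.exp (-Real.log 2 * s)) +
        (2 ^ (2 * n + 1))⁻¹ * (Real.log 3 ^ (2 * n + 1) * Real.exp (-Real.log 3 * s)) : ℝ) : ℂ) := by
    push_cast
    field_simp
    ring
  rw [hval, Complex.zero_lt_real]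
  have hl2 : 0 < Real.log 2 := Real.log_pos (by norm_num)
  have hl3 : 0 < Real.log 3 := Real.log_pos (by norm_num)
  have hl2' : Real.log 2 < 0.6931471808 := Real.log_two_lt_d9
  have h1 : Real.log 2 ^ (2 * n + 1) ≤ Real.log 2 :=
    pow_le_of_le_one hl2.le (by linarith) (by omega)
  -- `0.708` slightly exceeds `2^(-1/2)`, and `2 · 0.6931471808 · 0.708 < 1`.
  have h2 : Real.exp (-Real.log 2 * s) ≤ 0.708 := by
    have hsq : Real.exp (-Real.log 2 * s) ^ 2 ≤ 1 / 2 := by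
      rw [← Real.exp_nat_mul, show (1 / 2 : ℝ) = Real.exp (-Real.log 2) by
        rw [Real.exp_neg, Real.exp_log (by norm_num)]; norm_num, Real.exp_le_exp]
      push_cast
      nlinarith
    nlinarith [Real.exp_pos (-Real.log 2 * s)]
  have h3 : Real.log 2 ^ (2 * n + 1) * Real.exp (-Real.log 2 * s) ≤ 0.6931471808 * 0.708 := by
    gcongr
    linarith
  have h4 : 0 < (2 ^ (2 * n + 1))⁻¹ * (Real.log 3 ^ (2 * n + 1) * Real.exp (-Real.log 3 * s)) := by
    positivity
  linarith

/-! ### Bernoulli kernels and partial fractions -/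

/-- The poles `2 π (k + 1)` of `1 / (exp t - 1)` divided by the imaginary unit. -/
noncomputable def bernoulliPole (k : ℕ) : ℝ := 2 * Real.pi * (k + 1)

theorem bernoulliPole_pos (k : ℕ) : 0 < bernoulliPole k := by
  have := Real.pi_pos
  unfold bernoulliPole
  positivity

/-- `(-1) ^ (j + 1) B_{2 j} / (2 j)!` -/
noncomputable def bernoulliCoeff (j : ℕ) : ℝ := (-1) ^ (j + 1) * bernoulli (2 * j) / (2 * j)!

theorem hasSum_bernoulliCoeff {j : ℕ} (hj : j ≠ 0) :
    HasSum (fun k => 2 / bernoulliPole k ^ (2 * j)) (bernoulliCoeff j) := by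
  have h := hasSum_zeta_nat hj
  -- Euler's formula for `ζ(2j)` is summed from index `0`, where the term is `1/0 = 0`; that term is
  -- dropped to match the poles.
  rw [← hasSum_nat_add_iff' 1] at h
  have h2 := h.mul_left (2 / (2 * Real.pi) ^ (2 * j))
  have hv : 2 / (2 * Real.pi) ^ (2 * j) * ((-1 : ℝ) ^ (j + 1) * (2 : ℝ) ^ (2 * j - 1) *
      Real.pi ^ (2 * j) * bernoulli (2 * j) / (2 * j)! -
        ∑ i ∈ Finset.range 1, 1 / (i : ℝ) ^ (2 * j)) = bernoulliCoeff j := by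
    have e : (2 : ℝ) ^ (2 * j) = 2 * 2 ^ (2 * j - 1) := by
      rw [← pow_succ', Nat.sub_add_cancel (by omega)]
    have := Real.pi_ne_zero
    rw [Finset.sum_range_one, Nat.cast_zero, zero_pow (by omega), div_zero, sub_zero, mul_pow, e,
      bernoulliCoeff]
    field_simp
  rw [← hv]
  refine h2.congr_fun fun k => ?_
  rw [bernoulliPole, mul_pow _ ((k : ℝ) + 1)]
  push_cast
  have := Real.pi_ne_zero
  field_simp

/-- The alternating remainders of the expansion of `1 / (exp t - 1) - 1 / t + 1 / 2` in powers
of `t`. -/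
noncomputable def bernoulliKernel (N : ℕ) (t : ℝ) : ℝ :=
  ∑' k, 2 / bernoulliPole k ^ (2 * N) * poleKernel N (bernoulliPole k) t

theorem norm_bernoulliKernel_term_le (N : ℕ) (t : ℝ) (k : ℕ) :
    ‖2 / bernoulliPole k ^ (2 * N) * poleKernel N (bernoulliPole k) t‖ ≤
      2 / bernoulliPole k ^ (2 * (N + 1)) * |t| ^ (2 * N + 1) := by
  have hb := bernoulliPole_pos k
  rw [poleKernel, norm_mul, norm_div, norm_div, norm_pow, Real.norm_eq_abs, Real.norm_eq_abs,
    Real.norm_eq_abs, Real.norm_eq_abs, abs_of_pos (by positivity : 0 < t ^ 2 + _), abs_pow,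
    abs_of_pos hb, abs_two]
  calc 2 / bernoulliPole k ^ (2 * N) * (|t| ^ (2 * N + 1) / (t ^ 2 + bernoulliPole k ^ 2))
      ≤ 2 / bernoulliPole k ^ (2 * N) * (|t| ^ (2 * N + 1) / (bernoulliPole k ^ 2)) := by
        gcongr
        nlinarith [sq_nonneg t]
    _ = _ := by
        field_simp
        ring

theorem summable_bernoulliKernel (N : ℕ) (t : ℝ) :
    Summable fun k => 2 / bernoulliPole k ^ (2 * N) * poleKernel N (bernoulliPole k) t :=
  Summable.of_norm_bounded
    ((hasSum_bernoulliCoeff (Nat.succ_ne_zero N)).summable.mul_right _)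
    (norm_bernoulliKernel_term_le N t)

theorem expTame_bernoulliKernel (N : ℕ) : ExpTame (bernoulliKernel N) := by
  constructor
  · refine measurable_of_tendsto_metrizable (f := fun n t => ∑ k ∈ Finset.range n,
      2 / bernoulliPole k ^ (2 * N) * poleKernel N (bernoulliPole k) t) (fun n => ?_)
      (tendsto_pi_nhds.mpr fun t => (summable_bernoulliKernel N t).hasSum.tendsto_sum_nat)
    unfold poleKernel
    fun_prop
  · obtain ⟨C, hC⟩ := ((ExpTame.pow (2 * N + 1)).const_mul (bernoulliCoeff (N + 1))).2
    refine ⟨C, fun t ht => le_trans ?_ (hC t ht)⟩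
    have h := tsum_of_norm_bounded
      ((hasSum_bernoulliCoeff (Nat.succ_ne_zero N)).mul_right (|t| ^ (2 * N + 1)))
      (norm_bernoulliKernel_term_le N t)
    rw [abs_of_pos ht] at h
    exact h.trans (le_abs_self _)

/-- Termwise this is `poleKernel_succ`: the kernels cancel and the monomials add up to an even zeta
value. -/
theorem bernoulliKernel_add_succ (N : ℕ) (t : ℝ) :
    bernoulliKernel N t + bernoulliKernel (N + 1) t = bernoulliCoeff (N + 1) * t ^ (2 * N + 1) := by
  have h1 := (summable_bernoulliKernel N t).hasSum.add (summable_bernoulliKernel (N + 1) t).hasSum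
  refine h1.unique (((hasSum_bernoulliCoeff (Nat.succ_ne_zero N)).mul_right _).congr_fun
    fun k => ?_)
  have hb := bernoulliPole_pos k
  rw [poleKernel_succ N hb]
  field_simp
  ring

theorem bernoulliKernel_pos (N : ℕ) {t : ℝ} (ht : 0 < t) : 0 < bernoulliKernel N t := by
  have h : ∀ k, 0 < 2 / bernoulliPole k ^ (2 * N) * poleKernel N (bernoulliPole k) t := by
    intro k
    have hb := bernoulliPole_pos k
    unfold poleKernel
    positivity
  exact (summable_bernoulliKernel N t).tsum_pos (fun k => (h k).le) 0 (h 0)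

/-- The Mittag-Leffler expansion of `π cot(πx)` at the imaginary point `x = it/(2π)`. -/
theorem bernoulliKernel_zero {t : ℝ} (ht : 0 < t) :
    bernoulliKernel 0 t = 1 / (Real.exp t - 1) - 1 / t + 1 / 2 := by
  have hpi := Real.pi_ne_zero
  have hpiC : (Real.pi : ℂ) ≠ 0 := by exact_mod_cast hpi
  have htC : (t : ℂ) ≠ 0 := by exact_mod_cast ht.ne'
  set x : ℂ := (t : ℂ) * Complex.I / (2 * Real.pi) with hx
  have hxim : x.im ≠ 0 := by
    have : x = ((t / (2 * Real.pi) : ℝ) : ℂ) * Complex.I := by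
      rw [hx]
      push_cast
      ring
    have hv : x.im = t / (2 * Real.pi) := by
      rw [this, Complex.im_ofReal_mul, Complex.I_im, mul_one]
    rw [hv]
    positivity
  have hxZ : x ∈ Complex.integerComplement := by
    rw [Complex.mem_integerComplement_iff]
    rintro ⟨n, hn⟩
    apply hxim
    rw [← hn]
    simp
  have hcot := cot_series_rep' hxZ
  have hexp : Complex.exp (2 * Real.pi * Complex.I * x) = (Real.exp (-t) : ℂ) := by
    rw [hx, Complex.ofReal_exp]
    congr 1
    field_simp
    rw [Complex.I_sq]
    push_cast
    ring
  have hterm : ∀ k : ℕ, 1 / (x - (k + 1)) + 1 / (x + (k + 1)) = (-2 * Real.pi * Complex.I) *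
      ((2 / bernoulliPole k ^ (2 * 0) * poleKernel 0 (bernoulliPole k) t : ℝ) : ℂ) := by
    intro k
    have h1 : x - (k + 1) ≠ 0 := fun h => hxim (by simpa using congrArg Complex.im h)
    have h2 : x + (k + 1) ≠ 0 := fun h => hxim (by simpa using congrArg Complex.im h)
    have hb : (t : ℂ) ^ 2 + (2 * Real.pi * (k + 1)) ^ 2 ≠ 0 := by
      have hb := bernoulliPole_pos k
      have : t ^ 2 + (bernoulliPole k) ^ 2 ≠ 0 := by positivity
      have h := Complex.ofReal_ne_zero.mpr this
      rw [bernoulliPole] at h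
      push_cast at h
      exact h
    have hxx : (x - (k + 1)) * (x + (k + 1)) =
        -((t : ℂ) ^ 2 + (2 * Real.pi * (k + 1)) ^ 2) / (2 * Real.pi) ^ 2 := by
      rw [hx]
      field_simp
      ring_nf
      rw [Complex.I_sq]
      ring
    rw [one_div_add_one_div h1 h2, hxx]
    simp only [poleKernel, bernoulliPole]
    push_cast
    have e : x - (↑k + 1) + (x + (↑k + 1)) = (t : ℂ) * Complex.I / Real.pi := by
      rw [hx]
      field_simp
      ring
    rw [e]
    field_simp
  have hsum : ∑' k : ℕ, (1 / (x - (k + 1)) + 1 / (x + (k + 1))) =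
      (-2 * Real.pi * Complex.I) * (bernoulliKernel 0 t : ℂ) := by
    rw [tsum_congr hterm, tsum_mul_left, bernoulliKernel, Complex.ofReal_tsum]
  rw [hsum, Complex.cot_pi_eq_exp_ratio, hexp] at hcot
  have hE : Real.exp t - 1 ≠ 0 := by
    have := Real.add_one_lt_exp ht.ne'
    linarith
  have hE' : (Complex.exp t - 1 : ℂ) ≠ 0 := by
    have := Complex.ofReal_ne_zero.mpr hE
    push_cast at this
    exact this
  have hfrac : ((Real.exp (-t) : ℂ) + 1) / (Complex.I * (1 - (Real.exp (-t) : ℂ))) =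
      -Complex.I * (1 + 2 * (1 / (Complex.exp t - 1))) := by
    rw [Real.exp_neg]
    push_cast
    have h3 := Complex.exp_ne_zero (t : ℂ)
    have h4 : 1 - (Complex.exp (t : ℂ))⁻¹ ≠ 0 := by
      intro h
      apply hE'
      field_simp at h
      simpa using h
    have h5 : Complex.I ≠ 0 := Complex.I_ne_zero
    rw [div_eq_iff (mul_ne_zero h5 h4)]
    field_simp
    rw [Complex.I_sq]
    ring
  have h1x : 1 / x = -(2 * Real.pi * Complex.I) / t := by
    rw [hx]
    have h5 : Complex.I ≠ 0 := Complex.I_ne_zero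
    field_simp
    rw [Complex.I_sq]
    ring
  rw [hfrac, h1x] at hcot
  have hI : (2 * Real.pi * Complex.I : ℂ) ≠ 0 := Complex.two_pi_I_ne_zero
  have key : (bernoulliKernel 0 t : ℂ) =
      ((1 / (Real.exp t - 1) - 1 / t + 1 / 2 : ℝ) : ℂ) := by
    apply mul_left_cancel₀ hI
    push_cast
    linear_combination hcot
  exact_mod_cast key

/-! ### Zeta as a Gamma mean -/

/-- Here `1/(e^t-1)`, whose Mellin transform is `Γ(s) ζ(s)`, equals `e^(-t)(1/2 + B₀(t)) +
e^(-t)/t`, and the last summand contributes `Γ(s-1)/Γ(s) = 1/(s-1)`. -/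
theorem riemannZeta_eq_gammaMean {s : ℂ} (hs : 1 < s.re) :
    riemannZeta s = 1 / (s - 1) + gammaMean (fun t => 1 / 2 + bernoulliKernel 0 t) s := by
  have hs0 : 0 < s.re := by linarith
  have hs1 : 0 < (s - 1).re := by simpa using hs
  have hne : s - 1 ≠ 0 := fun h => by simp [h] at hs1
  have hΓ := Complex.Gamma_ne_zero_of_re_pos hs0
  have hgeom : ∀ t ∈ Ioi (0 : ℝ), HasSum (fun i : ℕ => (1 : ℂ) * Real.exp (-((i : ℝ) + 1) * t))
      (((Real.exp (-t) * (1 / 2 + bernoulliKernel 0 t) : ℝ) : ℂ) +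
        ((Real.exp (-t) * t⁻¹ : ℝ) : ℂ)) := by
    intro t ht
    have ht : 0 < t := ht
    have hr : Real.exp (-t) < 1 := by
      rw [Real.exp_lt_one_iff]
      linarith
    have hg := (hasSum_geometric_of_lt_one (Real.exp_pos (-t)).le hr).mul_left (Real.exp (-t))
    have hE : Real.exp t - 1 ≠ 0 := by
      have := Real.add_one_lt_exp ht.ne'
      linarith
    have hv : Real.exp (-t) * (1 - Real.exp (-t))⁻¹ =
        Real.exp (-t) * (1 / 2 + bernoulliKernel 0 t) + Real.exp (-t) * t⁻¹ := by
      have h1 : 1 - Real.exp (-t) ≠ 0 := by linarith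
      have h3 := Real.exp_ne_zero t
      rw [bernoulliKernel_zero ht, ← mul_add]
      congr 1
      rw [Real.exp_neg] at h1 ⊢
      have e : 1 / 2 + (1 / (Real.exp t - 1) - 1 / t + 1 / 2) + t⁻¹ =
          Real.exp t / (Real.exp t - 1) := by
        field_simp
        ring
      rw [e, inv_eq_iff_eq_inv, inv_div]
      field_simp
    rw [hv] at hg
    have hgC := Complex.hasSum_ofReal.mpr hg
    rw [Complex.ofReal_add] at hgC
    refine hgC.congr_fun fun i => ?_
    rw [one_mul, ← Real.exp_nat_mul, ← Real.exp_add]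
    ring_nf
  have hsumm : Summable fun i : ℕ => ‖(1 : ℂ)‖ / ((i : ℝ) + 1) ^ s.re := by
    simp only [norm_one]
    exact_mod_cast (summable_nat_add_iff 1).mpr (Real.summable_one_div_nat_rpow.mpr hs)
  have hM := hasSum_mellin (fun i => Or.inr (by positivity)) hs0 hgeom hsumm
  have hconv : MellinConvergent (fun t : ℝ => ((Real.exp (-t) * t⁻¹ : ℝ) : ℂ)) s ∧
      mellin (fun t : ℝ => ((Real.exp (-t) * t⁻¹ : ℝ) : ℂ)) s = Complex.Gamma (s - 1) := by
    have e : ∀ t ∈ Ioi (0 : ℝ), ((-t).exp : ℂ) * (t : ℂ) ^ (s - 1 - 1) =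
        (t : ℂ) ^ (s - 1) • ((Real.exp (-t) * t⁻¹ : ℝ) : ℂ) := by
      intro t ht
      have ht : (t : ℂ) ≠ 0 := by exact_mod_cast (ne_of_gt ht)
      rw [Complex.cpow_sub _ _ ht, Complex.cpow_one, smul_eq_mul]
      push_cast
      ring
    refine ⟨(Complex.GammaIntegral_convergent hs1).congr_fun e measurableSet_Ioi, ?_⟩
    rw [Complex.Gamma_eq_integral hs1, Complex.GammaIntegral]
    exact (setIntegral_congr_fun measurableSet_Ioi e).symm
  have hT : ExpTame fun t => 1 / 2 + bernoulliKernel 0 t :=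
    (ExpTame.const _).add (expTame_bernoulliKernel 0)
  have hadd := (hasMellin_add (hT.mellinConvergent hs0) hconv.1).2
  rw [hconv.2] at hadd
  have hz : Complex.Gamma s * riemannZeta s =
      mellin (fun t : ℝ => ((Real.exp (-t) * (1 / 2 + bernoulliKernel 0 t) : ℝ) : ℂ)) s +
        Complex.Gamma (s - 1) := by
    rw [← hadd, ← hM.tsum_eq, zeta_eq_tsum_one_div_nat_add_one_cpow hs, ← tsum_mul_left]
    refine tsum_congr fun i => ?_
    push_cast
    ring
  have hΓ1 : Complex.Gamma s = (s - 1) * Complex.Gamma (s - 1) := by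
    rw [← Complex.Gamma_add_one _ hne, sub_add_cancel]
  have hΓ2 : Complex.Gamma (s - 1) ≠ 0 := Complex.Gamma_ne_zero_of_re_pos hs1
  rw [gammaMean]
  apply mul_left_cancel₀ hΓ
  rw [hz, mul_add, mul_inv_cancel_left₀ hΓ, hΓ1]
  field_simp
  ring

/-- Both sides are analytic on the half plane `Re s > 0` and agree near `s = 2`, so the identity
reaches `s = 1`. -/
theorem zetaRegularPart_eq_gammaMean {s : ℂ} (hs : 0 < s.re) :
    zetaRegularPart s = 1 / 2 + gammaMean (bernoulliKernel 0) s := by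
  have hT : ExpTame fun t => 1 / 2 + bernoulliKernel 0 t :=
    (ExpTame.const _).add (expTame_bernoulliKernel 0)
  have hconst : gammaMean (fun _ => 1 / 2) s = 1 / 2 := by
    have h := gammaMean_const_mul (1 / 2) (fun t => t ^ 0) s
    rw [gammaMean_pow 0 hs] at h
    simpa using h
  rw [← hconst, ← (ExpTame.const (1 / 2)).gammaMean_add (expTame_bernoulliKernel 0) hs]
  have ho : IsOpen {z : ℂ | 0 < z.re} := isOpen_lt continuous_const Complex.continuous_re
  have ho1 : IsOpen {z : ℂ | 1 < z.re} := isOpen_lt continuous_const Complex.continuous_re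
  have hpre : IsPreconnected {z : ℂ | 0 < z.re} :=
    (convex_halfSpace_re_gt 0).isPreconnected
  have h1 : AnalyticOnNhd ℂ zetaRegularPart {z : ℂ | 0 < z.re} := fun z _ =>
    differentiable_zetaRegularPart.analyticAt z
  have h2 : AnalyticOnNhd ℂ (gammaMean fun t => 1 / 2 + bernoulliKernel 0 t)
      {z : ℂ | 0 < z.re} := fun z hz => hT.analyticAt_gammaMean hz
  refine h1.eqOn_of_preconnected_of_eventuallyEq h2 hpre (z₀ := 2) (by simp) ?_ hs
  filter_upwards [ho1.mem_nhds (show (1 : ℝ) < (2 : ℂ).re by simp)] with z hz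
  have hz1 : z ≠ 1 := fun h => by simp [h] at hz
  rw [zetaRegularPart, Function.update_of_ne hz1, riemannZeta_eq_gammaMean hz]
  ring

/-! ### Stirling numbers and the remainder recursion -/

/-- Shifting by `1` gives `(X+1)⋯(X+n)`, the rising factorial of length `n+1` divided by `X`; hence
both indices move by one. -/
theorem taylor_one_ascPochhammer_coeff (n m : ℕ) :
    (Polynomial.taylor (1 : ℂ) (ascPochhammer ℂ n)).coeff m =
      Nat.stirlingFirst (n + 1) (m + 1) := by
  induction n generalizing m with
  | zero => cases m <;> simp [Polynomial.coeff_one, Nat.stirlingFirst]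
  | succ n ih =>
    have e : Polynomial.taylor (1 : ℂ) (ascPochhammer ℂ (n + 1)) =
        Polynomial.taylor 1 (ascPochhammer ℂ n) * Polynomial.X +
          Polynomial.taylor 1 (ascPochhammer ℂ n) * Polynomial.C ((n : ℂ) + 1) := by
      rw [ascPochhammer_succ_right, Polynomial.taylor_mul, ← Polynomial.C_eq_natCast, map_add,
        Polynomial.taylor_X, Polynomial.taylor_C, ← mul_add]
      simp only [map_add, map_one]
      ring
    rw [e, Polynomial.coeff_add, Polynomial.coeff_mul_C, ih,
      Nat.stirlingFirst_succ_succ (n + 1) m]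
    cases m with
    | zero =>
      simp
      ring
    | succ m =>
      rw [Polynomial.coeff_mul_X, ih]
      push_cast
      ring

/-- The remainder of the Euler–Maclaurin type expansion of the Taylor coefficients of `ζ` at `1`. -/
noncomputable def stieltjesRemainder (m N : ℕ) : ℂ :=
  iteratedDeriv m (gammaMean (bernoulliKernel N)) 1

theorem stieltjesRemainder_add_succ (m N : ℕ) :
    stieltjesRemainder m N + stieltjesRemainder m (N + 1) =
      ((m ! * Nat.stirlingFirst (2 * (N + 1)) (m + 1) * bernoulliCoeff (N + 1) : ℝ) : ℂ) := by
  have ho : IsOpen {z : ℂ | 0 < z.re} := isOpen_lt continuous_const Complex.continuous_re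
  have h1 : 0 < (1 : ℂ).re := by simp
  have he : (fun s => gammaMean (bernoulliKernel N) s + gammaMean (bernoulliKernel (N + 1)) s)
      =ᶠ[𝓝 1] fun s => (bernoulliCoeff (N + 1) : ℂ) * (ascPochhammer ℂ (2 * N + 1)).eval s := by
    filter_upwards [ho.mem_nhds h1] with z hz
    rw [← (expTame_bernoulliKernel N).gammaMean_add (expTame_bernoulliKernel (N + 1)) hz,
      ← gammaMean_pow _ hz, ← gammaMean_const_mul]
    simp only [bernoulliKernel_add_succ]
  have h := he.iteratedDeriv_eq m
  rw [iteratedDeriv_fun_add ((expTame_bernoulliKernel N).analyticAt_gammaMean h1).contDiffAt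
    ((expTame_bernoulliKernel (N + 1)).analyticAt_gammaMean h1).contDiffAt,
    iteratedDeriv_const_mul_field, iteratedDeriv_polynomial_eval,
    taylor_one_ascPochhammer_coeff] at h
  rw [stieltjesRemainder, stieltjesRemainder, h, show 2 * (N + 1) = 2 * N + 1 + 1 by ring]
  push_cast
  ring

theorem stieltjesTerm_succ (m N : ℕ) :
    (stieltjesTerm m (N + 1) : ℝ) = (-1) ^ (m + N) *
      (m ! * Nat.stirlingFirst (2 * (N + 1)) (m + 1) * bernoulliCoeff (N + 1)) := by
  have h1 : (-1 : ℝ) ^ (m + N) * (-1) ^ (N + 1 + 1) = (-1) ^ m := by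
    rw [← pow_add, show m + N + (N + 1 + 1) = m + 2 * (N + 1) by ring, pow_add, pow_mul]
    simp
  rw [stieltjesTerm, bernoulliCoeff]
  push_cast
  rw [← h1]
  ring

theorem stieltjesConst_eq (m N : ℕ) :
    stieltjesConst m =
      ((stieltjesPartialSum m N : ℝ) : ℂ) + (-1) ^ (m + N) * stieltjesRemainder m N := by
  induction N with
  | zero =>
    have ho : IsOpen {z : ℂ | 0 < z.re} := isOpen_lt continuous_const Complex.continuous_re
    have h1 : 0 < (1 : ℂ).re := by simp
    have he : zetaRegularPart =ᶠ[𝓝 1] fun s => 1 / 2 + gammaMean (bernoulliKernel 0) s := by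
      filter_upwards [ho.mem_nhds h1] with z hz
      exact zetaRegularPart_eq_gammaMean hz
    rw [stieltjesConst, he.iteratedDeriv_eq, iteratedDeriv_fun_add contDiffAt_const
      ((expTame_bernoulliKernel 0).analyticAt_gammaMean h1).contDiffAt, iteratedDeriv_const,
      stieltjesRemainder, stieltjesPartialSum]
    -- The constant `1/2` survives only the zeroth derivative, which produces the Kronecker delta.
    rcases Nat.eq_zero_or_pos m with rfl | hm
    · simp
    · simp [hm.ne']
  | succ N ih =>
    have hr := stieltjesRemainder_add_succ m N
    have hp : (stieltjesPartialSum m (N + 1) : ℝ) =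
        stieltjesPartialSum m N + stieltjesTerm m (N + 1) := by
      rw [stieltjesPartialSum, stieltjesPartialSum, Finset.sum_Icc_succ_top (by omega)]
      push_cast
      ring
    rw [ih, hp, stieltjesTerm_succ]
    push_cast at hr ⊢
    linear_combination (-1) ^ (m + N) * hr

/-! ### Strict positivity of the remainders -/

theorem fwdNonneg_bernoulliKernel {m n : ℕ} (h : m ≤ 2 * n + 1) :
    FwdNonneg m (bernoulliKernel (n + 1)) := by
  refine FwdNonneg.tsum (fun k => ?_) fun y _ => summable_bernoulliKernel _ y
  have hb := bernoulliPole_pos k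
  exact (fwdNonneg_poleKernel h hb).const_mul (by positivity)

/-- Only the pole `2π` is compared; the other poles contribute nonnegative differences. -/
theorem exists_fwdNonneg_bernoulliKernel_sub (n : ℕ) :
    ∃ c : ℝ, 0 < c ∧
      FwdNonneg (2 * n + 1) fun t => bernoulliKernel (n + 1) t - c * comparisonFun n t := by
  have hb := bernoulliPole_pos
  have hs := summable_bernoulliKernel (n + 1)
  refine ⟨2 / bernoulliPole 0 ^ (2 * (n + 1)) * ((2 * n + 1)! / (1 + bernoulliPole 0 ^ 2)),
    by have := hb 0; positivity, ?_⟩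
  have h0 := (fwdNonneg_poleKernel_sub n (hb 0)).const_mul
    (c := 2 / bernoulliPole 0 ^ (2 * (n + 1))) (by have := hb 0; positivity)
  have h1 : FwdNonneg (2 * n + 1) fun t => ∑' k, 2 / bernoulliPole (k + 1) ^ (2 * (n + 1)) *
      poleKernel (n + 1) (bernoulliPole (k + 1)) t := by
    refine FwdNonneg.tsum (fun k => ?_) fun y _ => (summable_nat_add_iff 1).mpr (hs y)
    have hb := bernoulliPole_pos (k + 1)
    exact (fwdNonneg_poleKernel le_rfl hb).const_mul (by positivity)
  refine (h0.add h1).congr fun y _ => ?_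
  rw [bernoulliKernel, (hs y).tsum_eq_zero_add]
  ring

/-- Without a derivative, pointwise positivity of the kernel suffices, so `N = 0` is allowed. -/
theorem stieltjesRemainder_zero_pos (N : ℕ) : 0 < stieltjesRemainder 0 N := by
  have hint : IntegrableOn (fun t : ℝ => t ^ ((1 : ℝ) - 1) *
      (Real.exp (-t) * bernoulliKernel N t)) (Ioi 0) := by
    have := ((expTame_bernoulliKernel N).integrableOn).re
    refine IntegrableOn.congr_fun (f := fun t => Real.exp (-t) * bernoulliKernel N t) ?_
      (fun t _ => by simp) measurableSet_Ioi
    exact this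
  have hpos : ∀ t ∈ Ioi (0 : ℝ), 0 < t ^ ((1 : ℝ) - 1) * (Real.exp (-t) * bernoulliKernel N t) :=
    fun t ht => mul_pos (Real.rpow_pos_of_pos ht _)
      (mul_pos (Real.exp_pos _) (bernoulliKernel_pos N ht))
  have hI : 0 < ∫ t in Ioi (0 : ℝ), t ^ ((1 : ℝ) - 1) *
      (Real.exp (-t) * bernoulliKernel N t) := by
    rw [setIntegral_pos_iff_support_of_nonneg_ae _ hint]
    · have : (Function.support fun t : ℝ => t ^ ((1 : ℝ) - 1) *
          (Real.exp (-t) * bernoulliKernel N t)) ∩ Ioi 0 = Ioi 0 := by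
        rw [inter_eq_right]
        exact fun t ht => (hpos t ht).ne'
      rw [this]
      simp
    · filter_upwards [ae_restrict_mem measurableSet_Ioi] with t ht
      exact (hpos t ht).le
  have e := gammaMean_ofReal (bernoulliKernel N) 1
  rw [Complex.ofReal_one] at e
  rw [stieltjesRemainder, iteratedDeriv_zero, e, Complex.zero_lt_real, Real.Gamma_one, inv_one,
    one_mul]
  exact hI

theorem stieltjesRemainder_pos {m N : ℕ} (h : m = 0 ∨ m + 1 ≤ 2 * N) :
    0 < stieltjesRemainder m N := by
  rcases h with rfl | h
  · exact stieltjesRemainder_zero_pos N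
  obtain ⟨n, rfl⟩ : ∃ n, N = n + 1 := ⟨N - 1, by omega⟩
  have hT := expTame_bernoulliKernel (n + 1)
  have hpos : ∀ s : ℝ, 1 / 2 < s → s ≤ 1 →
      0 < iteratedDeriv (2 * n + 1) (gammaMean (bernoulliKernel (n + 1))) s := by
    intro s hs _
    obtain ⟨c, hc, hF⟩ := exists_fwdNonneg_bernoulliKernel_sub n
    have hcT := (ExpTame.comparisonFun n).const_mul c
    have hs0 : 0 < s := by linarith
    have h1 := (hT.sub hcT).iteratedDeriv_gammaMean_nonneg hF hs0
    rw [hT.iteratedDeriv_gammaMean_sub hcT _ (by simpa using hs0),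
      funext (gammaMean_const_mul c (comparisonFun n)), iteratedDeriv_const_mul_field,
      sub_nonneg] at h1
    refine lt_of_lt_of_le ?_ h1
    exact mul_pos (by exact_mod_cast hc) (iteratedDeriv_gammaMean_comparisonFun_pos n hs)
  have := hT.iteratedDeriv_gammaMean_pos (M := 2 * n + 1)
    (fun j hj => fwdNonneg_bernoulliKernel hj) hpos (j := m) (by omega) (s := 1) (by norm_num)
    le_rfl
  rwa [Complex.ofReal_one] at this

/-! ### Divergence and conclusion -/

/-- Keeping only the first summand of the Stirling recurrence multiplies by `n+1` at each step. -/
theorem factorial_le_factorial_mul_stirlingFirst {m n : ℕ} (h : m ≤ n) :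
    n ! ≤ m ! * Nat.stirlingFirst (n + 1) (m + 1) := by
  induction n, h using Nat.le_induction with
  | base => simp [Nat.stirlingFirst_self]
  | succ n h ih =>
    rw [Nat.factorial_succ, Nat.stirlingFirst_succ_succ]
    nlinarith [Nat.zero_le (m ! * Nat.stirlingFirst (n + 1) m)]

theorem not_tendsto_stieltjesPartialSum (m : ℕ) :
    ¬ ∃ l : ℝ, Tendsto (fun N : ℕ => (stieltjesPartialSum m N : ℝ)) atTop (𝓝 l) := by
  rintro ⟨l, hl⟩
  have hterm : Tendsto (fun N : ℕ => (stieltjesTerm m (N + 1) : ℝ)) atTop (𝓝 0) := by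
    have h := ((tendsto_add_atTop_iff_nat 1).mpr hl).sub hl
    rw [sub_self] at h
    refine h.congr fun N => ?_
    rw [stieltjesPartialSum, stieltjesPartialSum, Finset.sum_Icc_succ_top (by omega)]
    push_cast
    ring
  have hpi := Real.pi_pos
  -- For `N ≥ m` the term has size at least `(2N+1)!/(2π)^(2N+2)`. The reciprocal of this bound
  -- tends to `0`, yet its product with the size of the term stays at least `1`, so the terms cannot
  -- tend to `0`.
  have hf : Tendsto (fun N : ℕ => 2 * Real.pi * ((2 * Real.pi) ^ (2 * N + 1) / (2 * N + 1)!))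
      atTop (𝓝 0) := by
    have h := (FloorSemiring.tendsto_pow_div_factorial_atTop (2 * Real.pi)).const_mul
      (2 * Real.pi)
    rw [mul_zero] at h
    exact h.comp (tendsto_atTop_mono (fun N => by omega : ∀ N : ℕ, N ≤ 2 * N + 1) tendsto_id)
  have hprod := hterm.abs.mul hf
  rw [abs_zero, zero_mul] at hprod
  refine absurd (ge_of_tendsto hprod (b := (1 : ℝ)) ?_) (by norm_num)
  filter_upwards [eventually_ge_atTop m] with N hN
  have hst : ((2 * N + 1)! : ℝ) ≤ m ! * Nat.stirlingFirst (2 * (N + 1)) (m + 1) := by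
    exact_mod_cast factorial_le_factorial_mul_stirlingFirst (show m ≤ 2 * N + 1 by omega)
  have hbc : 1 / (2 * Real.pi) ^ (2 * (N + 1)) ≤ bernoulliCoeff (N + 1) := by
    have h := le_hasSum (hasSum_bernoulliCoeff (Nat.succ_ne_zero N)) 0 fun k _ => by
      have := bernoulliPole_pos k
      positivity
    refine le_trans ?_ h
    have e : bernoulliPole 0 = 2 * Real.pi := by simp [bernoulliPole]
    rw [e]
    gcongr
    norm_num
  have hbc0 : 0 ≤ bernoulliCoeff (N + 1) := hbc.trans' (by positivity)
  rw [stieltjesTerm_succ, abs_mul, abs_pow, abs_neg, abs_one, one_pow, one_mul,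
    abs_of_nonneg (by positivity)]
  calc (1 : ℝ) = (2 * N + 1)! * (1 / (2 * Real.pi) ^ (2 * (N + 1))) *
        (2 * Real.pi * ((2 * Real.pi) ^ (2 * N + 1) / (2 * N + 1)!)) := by
        have : ((2 * N + 1)! : ℝ) ≠ 0 := by positivity
        rw [show 2 * (N + 1) = 2 * N + 1 + 1 by ring, pow_succ (2 * Real.pi) (2 * N + 1)]
        field_simp
    _ ≤ _ := by gcongr

theorem mainTheorem2 (m : ℕ) :
    (∀ N : ℕ, (m = 0 ∨ m + 1 ≤ 2 * N) →
      ∃ θ : ℝ, 0 < θ ∧ θ < 1 ∧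
        stieltjesConst m =
          (((stieltjesPartialSum m N : ℝ) + θ * (stieltjesTerm m (N + 1) : ℝ) : ℝ) : ℂ)) ∧
    ¬ ∃ l : ℝ, Tendsto (fun N : ℕ => (stieltjesPartialSum m N : ℝ)) atTop (𝓝 l) := by
  refine ⟨fun N hN => ?_, not_tendsto_stieltjesPartialSum m⟩
  have h1 := stieltjesRemainder_pos hN
  have h2 := stieltjesRemainder_pos (m := m) (N := N + 1) (by omega)
  -- Positivity in the order of `ℂ` includes being real.
  obtain ⟨r, hr⟩ : ∃ r : ℝ, (r : ℂ) = stieltjesRemainder m N :=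
    ⟨_, Complex.conj_eq_iff_re.mp (Complex.conj_eq_iff_im.mpr (Complex.pos_iff.mp h1).2.symm)⟩
  have hsum := stieltjesRemainder_add_succ m N
  have hterm := stieltjesTerm_succ m N
  have hconst := stieltjesConst_eq m N
  set τ : ℝ := m ! * Nat.stirlingFirst (2 * (N + 1)) (m + 1) * bernoulliCoeff (N + 1)
  have hr0 : 0 < r := by
    rw [← hr] at h1
    exact_mod_cast h1
  have hrτ : r < τ := by
    have h3 : stieltjesRemainder m N < (τ : ℂ) := hsum ▸ lt_add_of_pos_right _ h2
    rw [← hr] at h3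
    exact_mod_cast h3
  have hτ : 0 < τ := hr0.trans hrτ
  -- `τ` is the sum of two consecutive positive remainders, the first being `r`; hence the ratio
  -- lies strictly between `0` and `1`.
  refine ⟨r / τ, div_pos hr0 hτ, (div_lt_one hτ).mpr hrτ, ?_⟩
  have e : r / τ * ((-1) ^ (m + N) * τ) = (-1) ^ (m + N) * r := by
    field_simp
  rw [hconst, hterm, e, ← hr]
  push_cast
  rfl
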